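/- Let $\alpha>0$, $\nu\ge 0$ and $\lambda\in\mathbb C\setminus\{0\}$. For $f:(0,\infty)\to\mathbb C$ let $$(B_{\nu,-}^{-\alpha}f)(x)=\frac{1}{\Gamma(2\alpha)}\int_x^{\infty}\left(\frac{y^2-x^2}{2y}\right)^{2\alpha-1}{}_2F_1\!\left(\alpha+\frac{\nu-1}{2},\alpha;2\alpha;1-\frac{x^2}{y^2}\right)f(y)\,dy,\qquad x>0,$$ be the right-sided fractional Bessel integral (its kernel is positive), let $$E_{(1/\rho_1,\dots,1/\rho_m),(\mu_1,\dots,\mu_m)}(z)=\sum_{k=0}^\infty\frac{z^k}{\Gamma(\mu_1+k/\rho_1)\cdots\Gamma(\mu_m+k/\rho_m)}$$ be the multi-index Mittag-Leffler function, and put $$(R_\lambda f)(x)=-\frac1\lambda f(x)-\frac1{\lambda^2}\int_x^{\infty}f(y)\left(\frac{y^2-x^2}{2y}\right)^{2\alpha-1}\!\int_0^1 t^{\alpha-1}(1-t)^{\alpha-1}\left(1-\Big(1-\frac{x^2}{y^2}\Big)t\right)^{-\alpha-\frac{\nu-1}{2}}E_{(\alpha,\alpha),(\alpha,\alpha)}\!\left(\frac1\lambda\left(\frac14\,\frac{t(1-t)(y^2-x^2)^2}{y^2-(y^2-x^2)t}\right)^{\alpha}\right)dt\,dy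 .$$ Then $R_\lambda=(B_{\nu,-}^{-\alpha}-\lambda I)^{-1}$ in the following sense. (a) Let $f$ be measurable with $\sum_{k\ge0}|\lambda|^{-k}\big((B_{\nu,-}^{-\alpha})^k|f|\big)(x)<\infty$ for every $x>0$ (absolute convergence of the Neumann series). Then for every $x>0$ the double integral in $(R_\lambda f)(x)$ converges absolutely and $(R_\lambda f)(x)=-\frac1\lambda\sum_{k\ge0}\lambda^{-k}\big((B_{\nu,-}^{-\alpha})^kf\big)(x)$. Moreover, $g=R_\lambda f$ is the unique solution of $(B_{\nu,-}^{-\alpha}-\lambda I)g=f$ on $(0,\infty)$ in the class of all measurable $g$ such that $(B_{\nu,-}^{-\alpha}|g|)(x)<\infty$ and $|\lambda|^{-k}\big((B_{\nu,-}^{-\alpha})^k|g|\big)(x)\to0$ as $k\to\infty$ for every $x>0$. (b) Let $c>0$ with $c^{-2\alpha}<|\lambda|$, and let $\Phi_c$ be the space of continuous $f:(0,\infty)\to\mathbb C$ with $f(x)=O(e^{-cx})$ as $x\to\infty$. Every $f\in\Phi_c$ satisfies the hypothesis of (a), $B_{\nu,-}^{-\alpha}$ and $R_\lambda$ map $\Phi_c$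 into itself, and for $f,g\in\Phi_c$ one has $(B_{\nu,-}^{-\alpha}-\lambda I)g=f$ if and only if $g=R_\lambda f$; that is, $B_{\nu,-}^{-\alpha}-\lambda I$ is a bijection of $\Phi_c$ with inverse $R_\lambda$. -/

import Mathlib

open MeasureTheory Set Filter Topology
open scoped ENNReal

noncomputable section

/-- The kernel of the right-sided fractional Bessel integral, `0 < x < y`:
`(1 / Γ(2α)) ((y² - x²) / (2y)) ^ (2α - 1) ₂F₁(α + (ν - 1)/2, α; 2α; 1 - x²/y²)`. -/
def besselKernel (α ν x y : ℝ) : ℝ :=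
  1 / Real.Gamma (2 * α) * ((y ^ 2 - x ^ 2) / (2 * y)) ^ (2 * α - 1) *
    ordinaryHypergeometric (α + (ν - 1) / 2) α (2 * α) (1 - x ^ 2 / y ^ 2)

/-- The right-sided fractional Bessel integral `B_{ν,-}^{-α} f` on the half-line `(0, ∞)`. Only the
values of `f` on `(x, ∞)` enter into the value at `x`, and only values at `x > 0` are meaningful. -/
def besselIntegral (α ν : ℝ) (f : ℝ → ℂ) (x : ℝ) : ℂ :=
  ∫ y in Ioi x, (besselKernel α ν x y : ℂ) * f y

/-- The same integral operator on nonnegative functions, with values in `[0, ∞]`; used to speak of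
absolute convergence. -/
def besselLIntegral (α ν : ℝ) (h : ℝ → ℝ≥0∞) (x : ℝ) : ℝ≥0∞ :=
  ∫⁻ y in Ioi x, ‖besselKernel α ν x y‖ₑ * h y

/-- The `k`-th power of `B_{ν,-}^{-α}` applied to `|f|`, with values in `[0, ∞]`. -/
def besselAbsIter (α ν : ℝ) (f : ℝ → ℂ) (k : ℕ) : ℝ → ℝ≥0∞ :=
  (besselLIntegral α ν)^[k] (fun y => ‖f y‖ₑ)

/-- The multi-index Mittag-Leffler function `E_{(a₁,…,aₘ),(μ₁,…,μₘ)}(z)`, where `aᵢ = 1/ρᵢ`: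
`∑ₖ zᵏ / (Γ(μ₁ + k a₁) ⋯ Γ(μₘ + k aₘ))`. -/
def multiMittagLeffler {m : ℕ} (a μ : Fin m → ℝ) (z : ℂ) : ℂ :=
  ∑' k : ℕ, z ^ k / ∏ i, (Real.Gamma (μ i + k * a i) : ℂ)

/-- The integrand, without the factor `f y`, of the double integral in the resolvent formula. -/
def resolventIntegrand (α ν : ℝ) (lam : ℂ) (x y t : ℝ) : ℂ :=
  ((((y ^ 2 - x ^ 2) / (2 * y)) ^ (2 * α - 1) * (t ^ (α - 1) * (1 - t) ^ (α - 1) *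
    (1 - (1 - x ^ 2 / y ^ 2) * t) ^ (-α - (ν - 1) / 2)) : ℝ) : ℂ) *
    multiMittagLeffler ![α, α] ![α, α]
      (1 / lam * (((1 / 4 * (t * (1 - t) * (y ^ 2 - x ^ 2) ^ 2 /
        (y ^ 2 - (y ^ 2 - x ^ 2) * t))) ^ α : ℝ) : ℂ))

/-- The right-hand side of the resolvent formula. -/
def resolventFormula (α ν : ℝ) (lam : ℂ) (f : ℝ → ℂ) (x : ℝ) : ℂ :=
  -(1 / lam) * f x - 1 / lam ^ 2 *
    ∫ y in Ioi x, f y * ∫ t in (0 : ℝ)..1, resolventIntegrand α ν lam x y t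

/-- The Neumann series `∑ₖ λ⁻ᵏ (B_{ν,-}^{-α})ᵏ f` converges absolutely at every point of `(0, ∞)`. -/
def NeumannConvergent (α ν : ℝ) (lam : ℂ) (f : ℝ → ℂ) : Prop :=
  AEStronglyMeasurable f (volume.restrict (Ioi 0)) ∧
    ∀ x, 0 < x → ∑' k : ℕ, (‖lam‖ₑ⁻¹) ^ k * besselAbsIter α ν f k x < ∞

/-- The class in which the resolvent equation is solved: `B_{ν,-}^{-α} g` is given by an absolutely
convergent integral on `(0, ∞)`, and `|λ|⁻ᵏ (B_{ν,-}^{-α})ᵏ |g| → 0` pointwise. -/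
def NeumannNull (α ν : ℝ) (lam : ℂ) (g : ℝ → ℂ) : Prop :=
  AEStronglyMeasurable g (volume.restrict (Ioi 0)) ∧
    ∀ x, 0 < x → besselAbsIter α ν g 1 x < ∞ ∧
      Tendsto (fun k : ℕ => (‖lam‖ₑ⁻¹) ^ k * besselAbsIter α ν g k x) atTop (𝓝 0)

/-- `(B_{ν,-}^{-α} - λ I) g = f` on `(0, ∞)`. -/
def SolvesResolventEq (α ν : ℝ) (lam : ℂ) (f g : ℝ → ℂ) : Prop :=
  ∀ x, 0 < x → besselIntegral α ν g x - lam * g x = f x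

/-- Continuous functions on `(0, ∞)` that are `O(e^{-cx})` as `x → ∞`. -/
def ExpDecaying (c : ℝ) (f : ℝ → ℂ) : Prop :=
  ContinuousOn f (Ioi 0) ∧ f =O[atTop] fun x => Real.exp (-(c * x))

end

/-! The resolvent is a Neumann series, and the fractional Bessel integrals form a semigroup in their
order, so the powers in that series are again single integrals with explicit kernels. Write `W_s`
for the Weyl integral of order `s` in the variable `x²`. Euler's integral for ₂F₁ shows that the
Bessel integral of order `s` is `4^(-s) W_s w^(-(ν-1)-2s) W_s y^(ν-1)` (`besselEKernel`). The
semigroup law `lintegral_besselEKernel_comp` then rests on two facts: `W_s W_t = W_(s+t)`, and the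
inversion `w ↦ xy/w`, which lets `W_a` and `W_b` trade places across a power weight. Kernels take
values in `[0, ∞]`, so that Tonelli applies without integrability conditions.

The `k`-th power of the operator thus has order `kα`. In Euler form the kernels of orders `(k+1)α`,
weighted by `λ^(-k)`, sum under the `t`-integral to the Mittag-Leffler function
(`hasSum_resolventIntegrand`). Absolute convergence of the Neumann series is exactly the bound that
permits termwise integration. The resulting sum solves the equation by telescoping. It is the only
solution because a difference `d` of two solutions satisfies `d = λ⁻¹ B d`, hence is bounded by null
sequences after iteration.

For exponentially decaying functions, `besselEKernel_le` bounds the kernel of order `s` by `2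
(y/x)^ν` times the Riemann–Liouville kernel of order `2s`. For every `c' < c` this gives iterates of
size `c'^(-2αk) e^(-cx)` with a constant independent of `k`, so the Neumann series is dominated by a
geometric one once `c'^(-2α) < |λ|`. -/

/-! ### Beta integrals and Euler's representation of ₂F₁. -/

theorem lintegral_rpow_mul_one_sub_rpow {a b : ℝ} (ha : 0 < a) (hb : 0 < b) :
    ∫⁻ t in Ioo (0 : ℝ) 1, ENNReal.ofReal (t ^ (a - 1) * (1 - t) ^ (b - 1)) =
      ENNReal.ofReal (Real.Gamma a * Real.Gamma b / Real.Gamma (a + b)) := by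
  have h := ProbabilityTheory.lintegral_betaPDF_eq_one ha hb
  have hB := ProbabilityTheory.beta_pos ha hb
  rw [ProbabilityTheory.lintegral_betaPDF] at h
  have h2 : ∀ t : ℝ, ENNReal.ofReal (1 / ProbabilityTheory.beta a b * t ^ (a - 1) *
      (1 - t) ^ (b - 1)) = ENNReal.ofReal (1 / ProbabilityTheory.beta a b) *
        ENNReal.ofReal (t ^ (a - 1) * (1 - t) ^ (b - 1)) := by
    intro t
    rw [mul_assoc, ENNReal.ofReal_mul (by positivity)]
  simp_rw [h2] at h
  rw [lintegral_const_mul' _ _ ENNReal.ofReal_ne_top] at h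
  change _ = ENNReal.ofReal (ProbabilityTheory.beta a b)
  calc _ = ENNReal.ofReal (ProbabilityTheory.beta a b) *
        (ENNReal.ofReal (1 / ProbabilityTheory.beta a b) *
        ∫⁻ t in Ioo (0 : ℝ) 1, ENNReal.ofReal (t ^ (a - 1) * (1 - t) ^ (b - 1))) := by
        rw [← mul_assoc, ← ENNReal.ofReal_mul hB.le, mul_one_div_cancel hB.ne']
        simp
    _ = _ := by rw [h, mul_one]

theorem integrableOn_rpow_mul_one_sub_rpow {a b : ℝ} (ha : 0 < a) (hb : 0 < b) :
    IntegrableOn (fun t : ℝ => t ^ (a - 1) * (1 - t) ^ (b - 1)) (Ioo 0 1) := by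
  refine ⟨by fun_prop, ?_⟩
  rw [hasFiniteIntegral_iff_ofReal, lintegral_rpow_mul_one_sub_rpow ha hb]
  · exact ENNReal.ofReal_lt_top
  · refine (ae_restrict_iff' measurableSet_Ioo).2 (ae_of_all _ fun t ht => ?_)
    have := ht.1
    have : 0 < 1 - t := sub_pos.2 ht.2
    simp only [Pi.zero_apply]
    positivity

theorem integral_rpow_mul_one_sub_rpow {a b : ℝ} (ha : 0 < a) (hb : 0 < b) :
    ∫ t in Ioo (0 : ℝ) 1, t ^ (a - 1) * (1 - t) ^ (b - 1) =
      Real.Gamma a * Real.Gamma b / Real.Gamma (a + b) := by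
  rw [integral_eq_lintegral_of_nonneg_ae, lintegral_rpow_mul_one_sub_rpow ha hb,
    ENNReal.toReal_ofReal]
  · have := Real.Gamma_pos_of_pos ha
    have := Real.Gamma_pos_of_pos hb
    have := Real.Gamma_pos_of_pos (add_pos ha hb)
    positivity
  · refine (ae_restrict_iff' measurableSet_Ioo).2 (ae_of_all _ fun t ht => ?_)
    have := ht.1
    have : 0 < 1 - t := sub_pos.2 ht.2
    simp only [Pi.zero_apply]
    positivity
  · fun_prop

theorem Real.Gamma_add_nat_eq_ascPochhammer {b : ℝ} (hb : 0 < b) (n : ℕ) :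
    Real.Gamma (b + n) = (ascPochhammer ℝ n).eval b * Real.Gamma b := by
  induction n with
  | zero => simp
  | succ n ih =>
    rw [ascPochhammer_succ_eval, Nat.cast_succ, ← add_assoc,
      Real.Gamma_add_one (by positivity), ih]
    ring

theorem hasSum_one_sub_rpow_neg (a : ℝ) {x : ℝ} (hx : |x| < 1) :
    HasSum (fun n : ℕ => ((n.factorial : ℝ)⁻¹ * (ascPochhammer ℝ n).eval a) * x ^ n)
      ((1 - x) ^ (-a)) := by
  have h := (Real.one_div_one_sub_rpow_hasFPowerSeriesOnBall_zero a).hasSum (y := x)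
    (by simpa [Metric.mem_eball, edist_dist, Real.dist_eq] using hx)
  have h1 : (1 - x) ^ (-a) = 1 / (1 - (0 + x)) ^ a := by
    rw [Real.rpow_neg (by linarith [abs_lt.1 hx]), zero_add, one_div]
  rw [h1]
  refine h.congr_fun fun n => ?_
  rw [FormalMultilinearSeries.ofScalars_apply_eq, smul_eq_mul, ← Ring.multichoose_eq]
  congr 1
  have := Ring.factorial_nsmul_multichoose_eq_ascPochhammer a n
  rw [Polynomial.ascPochhammer_smeval_eq_eval, nsmul_eq_mul] at this
  rw [← this, inv_mul_cancel_left₀ (by positivity)]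

/-- Euler's integral representation of the hypergeometric function. -/
theorem integral_euler_ordinaryHypergeometric (a : ℝ) {b d z : ℝ} (hb : 0 < b) (hd : 0 < d)
    (hz : |z| < 1) :
    ∫ t in Ioo (0 : ℝ) 1, t ^ (b - 1) * (1 - t) ^ (d - 1) * (1 - z * t) ^ (-a) =
      Real.Gamma b * Real.Gamma d / Real.Gamma (b + d) *
        ordinaryHypergeometric a b (b + d) z := by
  set c : ℕ → ℝ := fun n => (n.factorial : ℝ)⁻¹ * (ascPochhammer ℝ n).eval a with hc
  set F : ℕ → ℝ → ℝ := fun n t => (c n * z ^ n) * (t ^ ((b + n) - 1) * (1 - t) ^ (d - 1)) with hF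
  have hbn : ∀ n : ℕ, 0 < b + n := fun n => by positivity
  have hint : ∀ n, Integrable (F n) (volume.restrict (Ioo (0 : ℝ) 1)) := fun n =>
    (integrableOn_rpow_mul_one_sub_rpow (hbn n) hd).const_mul _
  have hval : ∀ n, ∫ t in Ioo (0 : ℝ) 1, F n t = Real.Gamma b * Real.Gamma d / Real.Gamma (b + d) *
      (((n.factorial : ℝ)⁻¹ * (ascPochhammer ℝ n).eval a * (ascPochhammer ℝ n).eval b *
        ((ascPochhammer ℝ n).eval (b + d))⁻¹) • z ^ n) := by
    intro n
    simp only [hF, hc]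
    rw [integral_const_mul, integral_rpow_mul_one_sub_rpow (hbn n) hd,
      Real.Gamma_add_nat_eq_ascPochhammer hb, show b + (n : ℝ) + d = (b + d) + n by ring,
      Real.Gamma_add_nat_eq_ascPochhammer (add_pos hb hd), smul_eq_mul]
    have := Real.Gamma_pos_of_pos (add_pos hb hd)
    have := ascPochhammer_pos n (b + d) (add_pos hb hd)
    field_simp
  have hpow : ∀ t ∈ Ioo (0 : ℝ) 1, ∀ n : ℕ, t ^ ((b + n) - 1) = t ^ (b - 1) * t ^ n := by
    intro t ht n
    rw [show b + (n : ℝ) - 1 = (b - 1) + n by ring, Real.rpow_add ht.1, Real.rpow_natCast]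
  have hsum : Summable fun n => ∫ t in Ioo (0 : ℝ) 1, ‖F n t‖ := by
    have hs : Summable fun n => ‖c n * z ^ n‖ :=
      (hasSum_one_sub_rpow_neg a hz).summable.norm
    -- Since `t ^ n ≤ 1`, every term is dominated by its binomial coefficient times the Beta
    -- integral with `n = 0`.
    refine Summable.of_nonneg_of_le (fun n => integral_nonneg fun t => norm_nonneg _) (fun n => ?_)
      (hs.mul_right (Real.Gamma b * Real.Gamma d / Real.Gamma (b + d)))
    rw [← integral_rpow_mul_one_sub_rpow hb hd, ← integral_const_mul]
    refine setIntegral_mono_on (hint n).norm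
      ((integrableOn_rpow_mul_one_sub_rpow hb hd).const_mul _) measurableSet_Ioo fun t ht => ?_
    have h0 := ht.1
    have h1 : 0 < 1 - t := sub_pos.2 ht.2
    simp only [hF]
    rw [norm_mul, Real.norm_of_nonneg 
      (r := t ^ (b + n - 1) * (1 - t) ^ (d - 1)) (by positivity), hpow t ht]
    refine mul_le_mul_of_nonneg_left (mul_le_mul_of_nonneg_right ?_ (by positivity))
      (norm_nonneg _)
    exact mul_le_of_le_one_right (by positivity) (pow_le_one₀ h0.le ht.2.le)
  have key := hasSum_integral_of_summable_integral_norm hint hsum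
  have h1 : ∫ t in Ioo (0 : ℝ) 1, ∑' n, F n t =
      ∫ t in Ioo (0 : ℝ) 1, t ^ (b - 1) * (1 - t) ^ (d - 1) * (1 - z * t) ^ (-a) := by
    refine setIntegral_congr_fun measurableSet_Ioo fun t ht => ?_
    have hzt : |z * t| < 1 := by
      rw [abs_mul, abs_of_pos ht.1]
      nlinarith [abs_nonneg z, ht.1, ht.2]
    have h := (hasSum_one_sub_rpow_neg a hzt).mul_left (t ^ (b - 1) * (1 - t) ^ (d - 1))
    rw [← h.tsum_eq]
    refine tsum_congr fun n => ?_
    simp only [hF, hc]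
    rw [hpow t ht, mul_pow]
    ring
  rw [← h1, ← key.tsum_eq, ordinaryHypergeometric_eq_tsum, ← tsum_mul_left]
  exact tsum_congr hval

/-! ### Changes of variable and Weyl kernels in the squared variable. -/

theorem lintegral_Ioo_zero_one_eq_sq {x y : ℝ} (hx : 0 < x) (hxy : x < y) (g : ℝ → ℝ≥0∞) :
    ∫⁻ t in Ioo (0 : ℝ) 1, g t = ∫⁻ w in Ioo x y, ENNReal.ofReal (2 * w / (y ^ 2 - x ^ 2)) *
      g ((y ^ 2 - w ^ 2) / (y ^ 2 - x ^ 2)) := by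
  have hD : 0 < y ^ 2 - x ^ 2 := by nlinarith
  have himg : (fun w : ℝ => (y ^ 2 - w ^ 2) / (y ^ 2 - x ^ 2)) '' Ioo x y = Ioo 0 1 := by
    ext t
    constructor
    · rintro ⟨w, ⟨h1, h2⟩, rfl⟩
      refine ⟨div_pos (by nlinarith) hD, (div_lt_one hD).2 (by nlinarith)⟩
    · rintro ⟨h0, h1⟩
      have hpos : 0 < y ^ 2 - (y ^ 2 - x ^ 2) * t := by nlinarith
      refine ⟨√(y ^ 2 - (y ^ 2 - x ^ 2) * t), ⟨?_, ?_⟩, ?_⟩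
      · exact Real.lt_sqrt_of_sq_lt (by nlinarith)
      · exact (Real.sqrt_lt' (hx.trans hxy)).2 (by nlinarith)
      · beta_reduce
        rw [Real.sq_sqrt hpos.le]
        field_simp
        ring
  rw [← himg, lintegral_image_eq_lintegral_abs_deriv_mul measurableSet_Ioo
    (f' := fun w => -(2 * w) / (y ^ 2 - x ^ 2))]
  · refine setLIntegral_congr_fun measurableSet_Ioo fun w hw => ?_
    have : 0 < w := hx.trans hw.1
    rw [abs_div, abs_neg, abs_of_pos hD, abs_of_pos (by positivity : 0 < 2 * w)]
  · intro w _
    have h : HasDerivAt (fun w : ℝ => (y ^ 2 - w ^ 2) / (y ^ 2 - x ^ 2))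
        (-(2 * w) / (y ^ 2 - x ^ 2)) w := by
      have := ((hasDerivAt_pow 2 w).const_sub (y ^ 2)).div_const (y ^ 2 - x ^ 2)
      simpa using this
    exact h.hasDerivWithinAt
  · intro w hw v hv h
    have h2 : (y ^ 2 - w ^ 2) = (y ^ 2 - v ^ 2) := by
      simpa [div_left_inj' hD.ne'] using h
    have : 0 < w := hx.trans hw.1
    have : 0 < v := hx.trans hv.1
    exact (sq_eq_sq₀ (by positivity) (by positivity)).1 (by linarith)

theorem lintegral_Ioo_eq_inversion {x y : ℝ} (hx : 0 < x) (hxy : x < y) (g : ℝ → ℝ≥0∞) :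
    ∫⁻ w in Ioo x y, g w = ∫⁻ w in Ioo x y, ENNReal.ofReal (x * y / w ^ 2) * g (x * y / w) := by
  have hy : 0 < y := hx.trans hxy
  have himg : (fun w : ℝ => x * y / w) '' Ioo x y = Ioo x y := by
    ext t
    constructor
    · rintro ⟨w, ⟨h1, h2⟩, rfl⟩
      have hw : 0 < w := hx.trans h1
      exact ⟨(lt_div_iff₀ hw).2 (by nlinarith), (div_lt_iff₀ hw).2 (by nlinarith)⟩
    · rintro ⟨h0, h1⟩
      have ht : 0 < t := hx.trans h0
      refine ⟨x * y / t, ⟨(lt_div_iff₀ ht).2 (by nlinarith), (div_lt_iff₀ ht).2 (by nlinarith)⟩, ?_⟩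
      field_simp
  conv_lhs => rw [← himg]
  rw [lintegral_image_eq_lintegral_abs_deriv_mul measurableSet_Ioo
    (f' := fun w => -(x * y / w ^ 2))]
  · refine setLIntegral_congr_fun measurableSet_Ioo fun w hw => ?_
    have : 0 < w := hx.trans hw.1
    rw [abs_neg, abs_of_pos (by positivity)]
  · intro w hw
    have hw0 : w ≠ 0 := (hx.trans hw.1).ne'
    have h : HasDerivAt (fun w : ℝ => x * y / w) (-(x * y / w ^ 2)) w := by
      have := (hasDerivAt_inv hw0).const_mul (x * y)
      simpa [div_eq_mul_inv] using this
    exact h.hasDerivWithinAt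
  · intro w hw v hv h
    have hw0 : w ≠ 0 := (hx.trans hw.1).ne'
    have hv0 : v ≠ 0 := (hx.trans hv.1).ne'
    have hxy0 : x * y ≠ 0 := by positivity
    simp only at h
    field_simp at h
    exact h.symm

/-- The kernel of the Weyl fractional integral of order `s` in the variable `x²`. -/
noncomputable def weylKernel (s x w : ℝ) : ℝ≥0∞ :=
  if 0 < x ∧ x < w then ENNReal.ofReal (2 * w * (w ^ 2 - x ^ 2) ^ (s - 1) / Real.Gamma s) else 0

theorem measurable_weylKernel (s : ℝ) : Measurable (Function.uncurry (weylKernel s)) := by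
  refine Measurable.ite ?_ (by fun_prop) measurable_const
  exact (measurableSet_lt measurable_const measurable_fst).inter
    (measurableSet_lt measurable_fst measurable_snd)

@[fun_prop]
theorem Measurable.weylKernel {β : Type*} [MeasurableSpace β] {f g : β → ℝ} (s : ℝ)
    (hf : Measurable f) (hg : Measurable g) : Measurable fun b => weylKernel s (f b) (g b) :=
  (measurable_weylKernel s).comp (hf.prodMk hg)

theorem weylKernel_of_lt {s x w : ℝ} (hx : 0 < x) (hw : x < w) :
    weylKernel s x w = ENNReal.ofReal (2 * w * (w ^ 2 - x ^ 2) ^ (s - 1) / Real.Gamma s) :=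
  if_pos ⟨hx, hw⟩

theorem weylKernel_of_not_lt {s x w : ℝ} (hw : ¬ x < w) : weylKernel s x w = 0 :=
  if_neg fun h => hw h.2

theorem weylKernel_of_nonpos {s x w : ℝ} (hx : x ≤ 0) : weylKernel s x w = 0 :=
  if_neg fun h => hx.not_gt h.1

theorem lintegral_weylKernel_mul_weylKernel (a b x y : ℝ) (G : ℝ → ℝ≥0∞) :
    ∫⁻ w, weylKernel a x w * G w * weylKernel b w y =
      ∫⁻ w in Ioo x y, weylKernel a x w * G w * weylKernel b w y := by
  rw [← lintegral_indicator measurableSet_Ioo]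
  refine lintegral_congr fun w => ?_
  by_cases hw : w ∈ Ioo x y
  · rw [indicator_of_mem hw]
  · rw [indicator_of_notMem hw]
    by_cases h1 : x < w
    · rw [weylKernel_of_not_lt (x := w) fun h2 => hw ⟨h1, h2⟩, mul_zero]
    · rw [weylKernel_of_not_lt h1, zero_mul, zero_mul]

/-- The substitution `(y² - w²)/(y² - x²)` reduces the composition to the Beta integral with
parameters `t` and `s`. -/
theorem lintegral_weylKernel_comp {s t : ℝ} (hs : 0 < s) (ht : 0 < t) (x y : ℝ) :
    ∫⁻ w, weylKernel s x w * weylKernel t w y = weylKernel (s + t) x y := by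
  by_cases h : 0 < x ∧ x < y
  swap
  · rw [weylKernel, if_neg h]
    refine (lintegral_congr fun w => ?_).trans lintegral_zero
    rw [mul_eq_zero]
    by_contra! hc
    refine h ⟨not_le.1 fun h => hc.1 (weylKernel_of_nonpos h), ?_⟩
    exact (not_not.1 fun h => hc.1 (weylKernel_of_not_lt h)).trans
      (not_not.1 fun h => hc.2 (weylKernel_of_not_lt h))
  obtain ⟨hx, hxy⟩ := h
  have hy : 0 < y := hx.trans hxy
  have hD : 0 < y ^ 2 - x ^ 2 := by nlinarith
  have hΓs := Real.Gamma_pos_of_pos hs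
  have hΓt := Real.Gamma_pos_of_pos ht
  have hΓ := Real.Gamma_pos_of_pos (add_pos ht hs)
  have h1 := lintegral_weylKernel_mul_weylKernel s t x y (fun _ => 1)
  simp only [mul_one] at h1
  have hB := lintegral_rpow_mul_one_sub_rpow ht hs
  rw [lintegral_Ioo_zero_one_eq_sq hx hxy] at hB
  have hC : 0 ≤ 2 * y * (y ^ 2 - x ^ 2) ^ (s + t - 1) / (Real.Gamma s * Real.Gamma t) := by
    positivity
  calc _ = ∫⁻ w in Ioo x y, ENNReal.ofReal
          (2 * y * (y ^ 2 - x ^ 2) ^ (s + t - 1) / (Real.Gamma s * Real.Gamma t)) *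
          (ENNReal.ofReal (2 * w / (y ^ 2 - x ^ 2)) *
          ENNReal.ofReal (((y ^ 2 - w ^ 2) / (y ^ 2 - x ^ 2)) ^ (t - 1) *
            (1 - (y ^ 2 - w ^ 2) / (y ^ 2 - x ^ 2)) ^ (s - 1))) := by
        rw [h1]
        refine setLIntegral_congr_fun measurableSet_Ioo fun w hw => ?_
        have hw0 : 0 < w := hx.trans hw.1
        have hP : 0 < y ^ 2 - w ^ 2 := by nlinarith [hw.2]
        have hQ : 0 < w ^ 2 - x ^ 2 := by nlinarith [hw.1]
        rw [weylKernel_of_lt hx hw.1, weylKernel_of_lt hw0 hw.2,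
          ← ENNReal.ofReal_mul (by positivity), ← ENNReal.ofReal_mul (by positivity),
          ← ENNReal.ofReal_mul hC]
        congr 1
        have e : 1 - (y ^ 2 - w ^ 2) / (y ^ 2 - x ^ 2) = (w ^ 2 - x ^ 2) / (y ^ 2 - x ^ 2) := by
          field_simp
          ring
        rw [e]
        -- Both sides are products of real powers of positive quantities, so after taking logarithms
        -- the identity becomes linear and `ring` closes it. The later uses of `Real.log_injOn_pos`
        -- work in the same way.
        refine Real.log_injOn_pos (mem_Ioi.2 (by positivity)) (mem_Ioi.2 (by positivity)) ?_
        simp (disch := positivity) only [Real.log_mul, Real.log_div, Real.log_rpow]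
        ring
    _ = _ := by
        rw [lintegral_const_mul' _ _ ENNReal.ofReal_ne_top, hB, ← ENNReal.ofReal_mul hC,
          weylKernel_of_lt hx hxy]
        congr 1
        rw [add_comm t s] at *
        field_simp

theorem lintegral_weylKernel_mul_weylKernel_of_not_lt (a b : ℝ) {x y : ℝ} (G : ℝ → ℝ≥0∞)
    (h : ¬ x < y) : ∫⁻ w, weylKernel a x w * G w * weylKernel b w y = 0 := by
  rw [lintegral_weylKernel_mul_weylKernel, Ioo_eq_empty h, setLIntegral_empty]

/-- Under `w ↦ xy/w` the factors `w² - x²` and `y² - w²` change places up to powers of `x`, `y` and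
`w`. The two orders can therefore be interchanged at the cost of new power weights. -/
theorem lintegral_weylKernel_inversion (a b p : ℝ) {x : ℝ} (y : ℝ) (hx : 0 < x)
    (ha : 0 < a) (hb : 0 < b) :
    ∫⁻ w, weylKernel a x w * ENNReal.ofReal (w ^ p) * weylKernel b w y =
      ENNReal.ofReal (x ^ (p + 2 * a)) * (∫⁻ w, weylKernel b x w *
        ENNReal.ofReal (w ^ (-p - 2 * a - 2 * b)) * weylKernel a w y) *
        ENNReal.ofReal (y ^ (p + 2 * b)) := by
  by_cases hxy : x < y
  swap
  · simp [lintegral_weylKernel_mul_weylKernel_of_not_lt _ _ _ hxy]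
  have hy : 0 < y := hx.trans hxy
  have hΓa := Real.Gamma_pos_of_pos ha
  have hΓb := Real.Gamma_pos_of_pos hb
  rw [lintegral_weylKernel_mul_weylKernel, lintegral_weylKernel_mul_weylKernel,
    lintegral_Ioo_eq_inversion hx hxy, ← lintegral_const_mul' _ _ ENNReal.ofReal_ne_top,
    ← lintegral_mul_const' _ _ ENNReal.ofReal_ne_top]
  refine setLIntegral_congr_fun measurableSet_Ioo fun w hw => ?_
  have hw0 : 0 < w := hx.trans hw.1
  have hP : 0 < y ^ 2 - w ^ 2 := by nlinarith [hw.2]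
  have hQ : 0 < w ^ 2 - x ^ 2 := by nlinarith [hw.1]
  have h1 : x < x * y / w := (lt_div_iff₀ hw0).2 (by nlinarith [hw.2])
  have h2 : x * y / w < y := (div_lt_iff₀ hw0).2 (by nlinarith [hw.1])
  have e1 : (x * y / w) ^ 2 - x ^ 2 = x ^ 2 * (y ^ 2 - w ^ 2) / w ^ 2 := by
    field_simp
  have e2 : y ^ 2 - (x * y / w) ^ 2 = y ^ 2 * (w ^ 2 - x ^ 2) / w ^ 2 := by
    field_simp
  rw [weylKernel_of_lt hx hw.1, weylKernel_of_lt hw0 hw.2, weylKernel_of_lt hx h1,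
    weylKernel_of_lt (by positivity) h2, e1, e2]
  simp (disch := positivity) only [← ENNReal.ofReal_mul]
  congr 1
  refine Real.log_injOn_pos (mem_Ioi.2 (by positivity)) (mem_Ioi.2 (by positivity)) ?_
  simp (disch := positivity) only [Real.log_mul, Real.log_div, Real.log_rpow, Real.log_pow]
  push_cast
  ring

/-! ### The Bessel kernel as a composition of Weyl kernels, and its semigroup law. -/

/-- The kernel of the right-sided fractional Bessel integral of order `s` as a composition of two
Weyl kernels with power weights, extended by `0` outside `0 < x < y`. -/
noncomputable def besselEKernel (s ν x y : ℝ) : ℝ≥0∞ :=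
  ENNReal.ofReal (4 ^ (-s)) *
    (∫⁻ w, weylKernel s x w * ENNReal.ofReal (w ^ (-(ν - 1) - 2 * s)) * weylKernel s w y) *
    ENNReal.ofReal (y ^ (ν - 1))

theorem measurable_besselEKernel (s ν : ℝ) :
    Measurable (Function.uncurry (besselEKernel s ν)) := by
  have : Measurable fun p : ℝ × ℝ => ∫⁻ w, weylKernel s p.1 w *
      ENNReal.ofReal (w ^ (-(ν - 1) - 2 * s)) * weylKernel s w p.2 :=
    Measurable.lintegral_prod_right' (f := fun q : (ℝ × ℝ) × ℝ => weylKernel s q.1.1 q.2 *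
      ENNReal.ofReal (q.2 ^ (-(ν - 1) - 2 * s)) * weylKernel s q.2 q.1.2) (by fun_prop)
  exact (this.const_mul _).mul (by fun_prop)

@[fun_prop]
theorem Measurable.besselEKernel {β : Type*} [MeasurableSpace β] {f g : β → ℝ} (s ν : ℝ)
    (hf : Measurable f) (hg : Measurable g) : Measurable fun b => besselEKernel s ν (f b) (g b) :=
  (measurable_besselEKernel s ν).comp (hf.prodMk hg)

theorem besselEKernel_of_not_lt {s ν x y : ℝ} (h : ¬ (0 < x ∧ x < y)) :
    besselEKernel s ν x y = 0 := by
  have : ∫⁻ w, weylKernel s x w * ENNReal.ofReal (w ^ (-(ν - 1) - 2 * s)) * weylKernel s w y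
      = 0 := by
    refine (lintegral_congr fun w => ?_).trans lintegral_zero
    rw [mul_eq_zero, mul_eq_zero]
    by_contra! hc
    refine h ⟨not_le.1 fun h => hc.1.1 (weylKernel_of_nonpos h), ?_⟩
    exact (not_not.1 fun h => hc.1.1 (weylKernel_of_not_lt h)).trans
      (not_not.1 fun h => hc.2 (weylKernel_of_not_lt h))
  rw [besselEKernel, this, mul_zero, zero_mul]

/-- Tonelli's theorem, in the form of associativity of the composition of kernels. -/
theorem lintegral_mul_lintegral_assoc {f : ℝ → ℝ≥0∞} {g : ℝ → ℝ → ℝ≥0∞} {h : ℝ → ℝ≥0∞}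
    (hf : Measurable f) (hg : Measurable (Function.uncurry g)) (hh : Measurable h) :
    ∫⁻ z, (∫⁻ w, f w * g w z) * h z = ∫⁻ w, f w * ∫⁻ z, g w z * h z := by
  have hg' : ∀ w, Measurable (g w) := fun w => hg.comp (measurable_const.prodMk measurable_id)
  have hg'' : ∀ z, Measurable fun w => g w z := fun z =>
    hg.comp (measurable_id.prodMk measurable_const)
  calc _ = ∫⁻ z, ∫⁻ w, f w * g w z * h z :=
        lintegral_congr fun z => (lintegral_mul_const _ (hf.mul (hg'' z))).symm
    _ = ∫⁻ w, ∫⁻ z, f w * g w z * h z := by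
        refine lintegral_lintegral_swap (Measurable.aemeasurable ?_)
        exact ((hf.comp measurable_snd).mul (hg.comp measurable_swap)).mul (hh.comp measurable_fst)
    _ = _ := by
        refine lintegral_congr fun w => ?_
        simp only [mul_assoc]
        exact lintegral_const_mul _ ((hg' w).mul hh)

/-- The semigroup property of the kernels of fractional Bessel integrals. -/
theorem lintegral_besselEKernel_comp {s t : ℝ} (hs : 0 < s) (ht : 0 < t) (ν x y : ℝ) :
    ∫⁻ z, besselEKernel s ν x z * besselEKernel t ν z y = besselEKernel (s + t) ν x y := by
  set p := ν - 1 with hp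
  have hpow : ∀ u r : ℝ, 0 < u → ENNReal.ofReal (u ^ r) * ENNReal.ofReal (u ^ (-r)) = 1 := by
    intro u r hu
    rw [← ENNReal.ofReal_mul (by positivity), ← Real.rpow_add hu]
    simp
  -- Inversion of the inner pair `W_s z^p W_t` produces the weight `ω^(p+2t)`, which cancels the
  -- weight already present. The two rightmost Weyl kernels are then adjacent and merge to order `s
  -- + t`. The outer weight `w^(p+2s)` that is left cancels in the same way in the main computation,
  -- where the two leftmost kernels merge.
  have hJ : ∀ w, 0 < w → ∫⁻ z, weylKernel s w z * (ENNReal.ofReal (z ^ p) *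
      ∫⁻ ω, weylKernel t z ω * (ENNReal.ofReal (ω ^ (-p - 2 * t)) * weylKernel t ω y)) =
      ENNReal.ofReal (w ^ (p + 2 * s)) * ∫⁻ z, weylKernel t w z *
        (ENNReal.ofReal (z ^ (-p - 2 * (s + t))) * weylKernel (s + t) z y) := by
    intro w hw
    calc _ = ∫⁻ z, weylKernel s w z * ENNReal.ofReal (z ^ p) *
            ∫⁻ ω, weylKernel t z ω * (ENNReal.ofReal (ω ^ (-p - 2 * t)) * weylKernel t ω y) := by
          simp only [mul_assoc]
      _ = ∫⁻ ω, (∫⁻ z, weylKernel s w z * ENNReal.ofReal (z ^ p) * weylKernel t z ω) *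
            (ENNReal.ofReal (ω ^ (-p - 2 * t)) * weylKernel t ω y) :=
          (lintegral_mul_lintegral_assoc (by fun_prop) (measurable_weylKernel t)
            (by fun_prop)).symm
      _ = ∫⁻ ω, ENNReal.ofReal (w ^ (p + 2 * s)) * ((∫⁻ z, weylKernel t w z *
            ENNReal.ofReal (z ^ (-p - 2 * (s + t))) * weylKernel s z ω) * weylKernel t ω y) := by
          refine lintegral_congr fun ω => ?_
          rcases le_or_gt ω 0 with hω | hω
          · simp [weylKernel_of_nonpos hω]
          rw [lintegral_weylKernel_inversion s t p ω hw hs ht,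
            show -p - 2 * t = -(p + 2 * t) by ring,
            show -p - 2 * s - 2 * t = -p - 2 * (s + t) by ring]
          calc _ = ENNReal.ofReal (w ^ (p + 2 * s)) * ((∫⁻ z, weylKernel t w z *
              ENNReal.ofReal (z ^ (-p - 2 * (s + t))) * weylKernel s z ω) * weylKernel t ω y) *
              (ENNReal.ofReal (ω ^ (p + 2 * t)) * ENNReal.ofReal (ω ^ (-(p + 2 * t)))) := by ring
            _ = _ := by rw [hpow ω _ hω, mul_one]
      _ = ENNReal.ofReal (w ^ (p + 2 * s)) * ∫⁻ z, weylKernel t w z *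
            ENNReal.ofReal (z ^ (-p - 2 * (s + t))) *
              ∫⁻ ω, weylKernel s z ω * weylKernel t ω y := by
          rw [lintegral_const_mul' _ _ ENNReal.ofReal_ne_top, lintegral_mul_lintegral_assoc
            (by fun_prop) (measurable_weylKernel s) (by fun_prop)]
      _ = _ := by simp only [lintegral_weylKernel_comp hs ht, mul_assoc]
  have hI : Measurable fun z => ∫⁻ ω, weylKernel t z ω *
      (ENNReal.ofReal (ω ^ (-p - 2 * t)) * weylKernel t ω y) :=
    Measurable.lintegral_prod_right' (f := fun q : ℝ × ℝ => weylKernel t q.1 q.2 *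
      (ENNReal.ofReal (q.2 ^ (-p - 2 * t)) * weylKernel t q.2 y)) (by fun_prop)
  have h4 : ENNReal.ofReal ((4 : ℝ) ^ (-s)) * ENNReal.ofReal ((4 : ℝ) ^ (-t)) =
      ENNReal.ofReal ((4 : ℝ) ^ (-(s + t))) := by
    rw [← ENNReal.ofReal_mul (by positivity), ← Real.rpow_add (by norm_num)]
    congr 2
    ring
  calc _ = ∫⁻ z, ENNReal.ofReal ((4 : ℝ) ^ (-(s + t))) * ENNReal.ofReal (y ^ p) *
        ((∫⁻ w, weylKernel s x w * ENNReal.ofReal (w ^ (-p - 2 * s)) * weylKernel s w z) *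
          (ENNReal.ofReal (z ^ p) * ∫⁻ ω, weylKernel t z ω *
            (ENNReal.ofReal (ω ^ (-p - 2 * t)) * weylKernel t ω y))) := by
        refine lintegral_congr fun z => ?_
        rw [besselEKernel, besselEKernel, ← h4]
        simp only [← mul_assoc, ← hp]
        ring
    _ = ENNReal.ofReal ((4 : ℝ) ^ (-(s + t))) * ENNReal.ofReal (y ^ p) *
          ∫⁻ w, weylKernel s x w * ENNReal.ofReal (w ^ (-p - 2 * s)) *
            ∫⁻ z, weylKernel s w z * (ENNReal.ofReal (z ^ p) * ∫⁻ ω, weylKernel t z ω *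
            (ENNReal.ofReal (ω ^ (-p - 2 * t)) * weylKernel t ω y)) := by
        rw [lintegral_const_mul' _ _ (by finiteness), lintegral_mul_lintegral_assoc
          (by fun_prop) (measurable_weylKernel s) (by fun_prop)]
    _ = ENNReal.ofReal ((4 : ℝ) ^ (-(s + t))) * ENNReal.ofReal (y ^ p) *
          ∫⁻ w, weylKernel s x w * ∫⁻ z, weylKernel t w z *
            (ENNReal.ofReal (z ^ (-p - 2 * (s + t))) * weylKernel (s + t) z y) := by
        congr 1
        refine lintegral_congr fun w => ?_
        by_cases hw : 0 < x ∧ x < w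
        · have hw0 := hw.1.trans hw.2
          rw [hJ w hw0, show -p - 2 * s = -(p + 2 * s) by ring]
          calc _ = weylKernel s x w * (∫⁻ z, weylKernel t w z *
              (ENNReal.ofReal (z ^ (-p - 2 * (s + t))) * weylKernel (s + t) z y)) *
              (ENNReal.ofReal (w ^ (p + 2 * s)) * ENNReal.ofReal (w ^ (-(p + 2 * s)))) := by ring
            _ = _ := by rw [hpow w _ hw0, mul_one]
        · simp [weylKernel, hw]
    _ = ENNReal.ofReal ((4 : ℝ) ^ (-(s + t))) * ENNReal.ofReal (y ^ p) *
          ∫⁻ z, (∫⁻ w, weylKernel s x w * weylKernel t w z) *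
            (ENNReal.ofReal (z ^ (-p - 2 * (s + t))) * weylKernel (s + t) z y) := by
        rw [lintegral_mul_lintegral_assoc (by fun_prop) (measurable_weylKernel t) (by fun_prop)]
    _ = _ := by
        rw [besselEKernel]
        simp only [lintegral_weylKernel_comp hs ht, ← mul_assoc, ← hp]
        ring

/-! ### A pointwise bound for the Bessel kernel. -/

/-- The substitution `t = (w - xy/w + y - x) / (2(y - x))` is increasing in `w` and satisfies
`t(1-t) = (w² - x²)(y² - w²) / (4w²(y - x)²)`. It turns the product of the two Weyl kernels into a
Beta integrand, with only powers of `y - x` in front. An inclusion of the image in `(0, 1)` suffices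
for the upper bound. -/
theorem lintegral_joukowski_le {x y : ℝ} (hx : 0 < x) (hxy : x < y) (g : ℝ → ℝ≥0∞) :
    ∫⁻ w in Ioo x y, ENNReal.ofReal ((1 + x * y / w ^ 2) / (2 * (y - x))) *
      g ((w + y) * (w - x) / (2 * w * (y - x))) ≤ ∫⁻ t in Ioo (0 : ℝ) 1, g t := by
  have hy : 0 < y := hx.trans hxy
  have hR : 0 < y - x := sub_pos.2 hxy
  have himg : (fun w : ℝ => (w + y) * (w - x) / (2 * w * (y - x))) '' Ioo x y ⊆ Ioo 0 1 := by
    rintro _ ⟨w, ⟨h1, h2⟩, rfl⟩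
    have hw : 0 < w := hx.trans h1
    have : 0 < w - x := sub_pos.2 h1
    refine ⟨by positivity, (div_lt_one (by positivity)).2 ?_⟩
    nlinarith [mul_pos (sub_pos.2 h2) (add_pos hw hx)]
  refine le_trans (le_of_eq ?_) (lintegral_mono_set himg)
  rw [lintegral_image_eq_lintegral_abs_deriv_mul measurableSet_Ioo
    (f' := fun w => (1 + x * y / w ^ 2) / (2 * (y - x)))]
  · refine setLIntegral_congr_fun measurableSet_Ioo fun w hw => ?_
    have : 0 < w := hx.trans hw.1
    rw [abs_of_pos (by positivity)]
  · intro w hw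
    have hw0 : w ≠ 0 := (hx.trans hw.1).ne'
    have h : HasDerivAt (fun w : ℝ => (w - x * y * w⁻¹ + (y - x)) / (2 * (y - x)))
        ((1 + x * y / w ^ 2) / (2 * (y - x))) w := by
      have := ((((hasDerivAt_id w).sub ((hasDerivAt_inv hw0).const_mul (x * y))).add_const
        (y - x)).div_const (2 * (y - x)))
      rw [show (1 + x * y / w ^ 2) = 1 - x * y * -(w ^ 2)⁻¹ by ring]
      exact this
    refine h.hasDerivWithinAt.congr (fun v hv => ?_) ?_
    · have hv0 : v ≠ 0 := (hx.trans hv.1).ne'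
      field_simp
      ring
    · field_simp
      ring
  · intro w hw v hv h
    have hw0 : 0 < w := hx.trans hw.1
    have hv0 : 0 < v := hx.trans hv.1
    beta_reduce at h
    rw [div_eq_div_iff (by positivity) (by positivity)] at h
    have h2 : (w - v) * (w * v + x * y) * (2 * (y - x)) = 0 := by linear_combination h
    have h3 : 0 < w * v + x * y := by positivity
    rcases mul_eq_zero.1 h2 with h4 | h4
    · rcases mul_eq_zero.1 h4 with h5 | h5
      · exact sub_eq_zero.1 h5
      · exact absurd h5 h3.ne'
    · exact absurd h4 (by positivity)

theorem besselEKernel_le {s ν x y : ℝ} (hs : 0 < s) (hν : 0 ≤ ν) (hx : 0 < x) (hxy : x < y) :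
    besselEKernel s ν x y ≤
      ENNReal.ofReal (2 * (y / x) ^ ν * ((y - x) ^ (2 * s - 1) / Real.Gamma (2 * s))) := by
  have hy : 0 < y := hx.trans hxy
  have hR : 0 < y - x := sub_pos.2 hxy
  have hΓ := Real.Gamma_pos_of_pos hs
  have hΓ2 := Real.Gamma_pos_of_pos (add_pos hs hs)
  have hC : 0 ≤ 2 * (y / x) ^ ν * (y - x) ^ (2 * s - 1) / Real.Gamma s ^ 2 := by positivity
  calc besselEKernel s ν x y
      = ∫⁻ w in Ioo x y, ENNReal.ofReal (4 ^ (-s)) * (weylKernel s x w *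
          ENNReal.ofReal (w ^ (-(ν - 1) - 2 * s)) * weylKernel s w y) *
          ENNReal.ofReal (y ^ (ν - 1)) := by
        rw [besselEKernel, lintegral_weylKernel_mul_weylKernel,
          lintegral_mul_const' _ _ ENNReal.ofReal_ne_top,
          lintegral_const_mul' _ _ ENNReal.ofReal_ne_top]
    _ ≤ ∫⁻ w in Ioo x y,
          ENNReal.ofReal (2 * (y / x) ^ ν * (y - x) ^ (2 * s - 1) / Real.Gamma s ^ 2) *
          (ENNReal.ofReal ((1 + x * y / w ^ 2) / (2 * (y - x))) *
          ENNReal.ofReal (((w + y) * (w - x) / (2 * w * (y - x))) ^ (s - 1) *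
            (1 - (w + y) * (w - x) / (2 * w * (y - x))) ^ (s - 1))) := by
        refine setLIntegral_mono' measurableSet_Ioo fun w hw => ?_
        have hw0 : 0 < w := hx.trans hw.1
        have hP : 0 < y - w := sub_pos.2 hw.2
        have hQ : 0 < w - x := sub_pos.2 hw.1
        have e : 1 - (w + y) * (w - x) / (2 * w * (y - x)) =
            (y - w) * (w + x) / (2 * w * (y - x)) := by
          field_simp
          ring
        have e1 : w ^ 2 - x ^ 2 = (w - x) * (w + x) := by ring
        have e2 : y ^ 2 - w ^ 2 = (y - w) * (w + y) := by ring
        rw [weylKernel_of_lt hx hw.1, weylKernel_of_lt hw0 hw.2, e, e1, e2]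
        simp (disch := positivity) only [← ENNReal.ofReal_mul]
        refine ENNReal.ofReal_le_ofReal ?_
        -- The integrand is rewritten exactly. The only losses are `(y/w)^ν ≤ (y/x)^ν`, which uses
        -- `ν ≥ 0`, and `1 ≤ 1 + xy/w²`.
        calc _ = 2 * (y / w) ^ ν * (y - x) ^ (2 * s - 1) / Real.Gamma s ^ 2 *
              (1 / (2 * (y - x)) *
              (((w + y) * (w - x) / (2 * w * (y - x))) ^ (s - 1) *
              ((y - w) * (w + x) / (2 * w * (y - x))) ^ (s - 1))) := by
              refine Real.log_injOn_pos (mem_Ioi.2 (by positivity)) (mem_Ioi.2 (by positivity)) ?_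
              rw [show (4 : ℝ) = 2 ^ 2 by norm_num]
              simp (disch := positivity) only [Real.log_mul, Real.log_div, Real.log_rpow,
                Real.log_pow, Real.log_one]
              push_cast
              ring
          _ ≤ _ := by
              have h1 : (y / w) ^ ν ≤ (y / x) ^ ν :=
                Real.rpow_le_rpow (by positivity)
                  (div_le_div_of_nonneg_left hy.le hx hw.1.le) hν
              have h2 : 1 / (2 * (y - x)) ≤ (1 + x * y / w ^ 2) / (2 * (y - x)) := by
                gcongr
                have : 0 ≤ x * y / w ^ 2 := by positivity
                linarith
              gcongr
    _ ≤ ENNReal.ofReal (2 * (y / x) ^ ν * (y - x) ^ (2 * s - 1) / Real.Gamma s ^ 2) *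
          ∫⁻ t in Ioo (0 : ℝ) 1, ENNReal.ofReal (t ^ (s - 1) * (1 - t) ^ (s - 1)) := by
        rw [lintegral_const_mul' _ _ ENNReal.ofReal_ne_top]
        refine mul_le_mul' le_rfl ?_
        exact lintegral_joukowski_le hx hxy
          (fun t => ENNReal.ofReal (t ^ (s - 1) * (1 - t) ^ (s - 1)))
    _ = _ := by
        rw [lintegral_rpow_mul_one_sub_rpow hs hs, ← ENNReal.ofReal_mul hC, ← two_mul] at *
        congr 1
        field_simp

theorem besselEKernel_lt_top {s ν x y : ℝ} (hs : 0 < s) (hν : 0 ≤ ν) :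
    besselEKernel s ν x y < ∞ := by
  by_cases h : 0 < x ∧ x < y
  · exact (besselEKernel_le hs hν h.1 h.2).trans_lt ENNReal.ofReal_lt_top
  · simp [besselEKernel_of_not_lt h]

/-! ### Identification with the hypergeometric kernel. -/

/-- The integrand in Euler's integral representation of `besselKernel s ν x y`. -/
noncomputable def eulerIntegrand (s ν x y t : ℝ) : ℝ :=
  ((y ^ 2 - x ^ 2) / (2 * y)) ^ (2 * s - 1) * (t ^ (s - 1) * (1 - t) ^ (s - 1) *
    (1 - (1 - x ^ 2 / y ^ 2) * t) ^ (-s - (ν - 1) / 2)) / Real.Gamma s ^ 2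

@[fun_prop]
theorem Measurable.eulerIntegrand {β : Type*} [MeasurableSpace β] {f g h : β → ℝ} (s ν : ℝ)
    (hf : Measurable f) (hg : Measurable g) (hh : Measurable h) :
    Measurable fun b => eulerIntegrand s ν (f b) (g b) (h b) := by
  unfold _root_.eulerIntegrand
  fun_prop

theorem one_sub_mul_pos {x y t : ℝ} (hx : 0 < x) (hxy : x < y) (ht : t ∈ Ioo (0 : ℝ) 1) :
    0 < 1 - (1 - x ^ 2 / y ^ 2) * t := by
  have hy : 0 < y := hx.trans hxy
  have h : 0 < x ^ 2 / y ^ 2 := by positivity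
  nlinarith [ht.1, ht.2, mul_pos h ht.1]

theorem eulerIntegrand_pos {s ν x y t : ℝ} (hs : 0 < s) (hx : 0 < x) (hxy : x < y)
    (ht : t ∈ Ioo (0 : ℝ) 1) : 0 < eulerIntegrand s ν x y t := by
  have hy : 0 < y := hx.trans hxy
  have hD : 0 < y ^ 2 - x ^ 2 := by nlinarith
  have h0 := ht.1
  have h1 : 0 < 1 - t := sub_pos.2 ht.2
  have h2 := one_sub_mul_pos hx hxy ht
  have hΓ := Real.Gamma_pos_of_pos hs
  unfold eulerIntegrand
  positivity

theorem besselEKernel_eq_lintegral_eulerIntegrand {s ν x y : ℝ} (hs : 0 < s) (hx : 0 < x)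
    (hxy : x < y) :
    besselEKernel s ν x y =
      ∫⁻ t in Ioo (0 : ℝ) 1, ENNReal.ofReal (eulerIntegrand s ν x y t) := by
  have hy : 0 < y := hx.trans hxy
  have hD : 0 < y ^ 2 - x ^ 2 := by nlinarith
  have hΓ := Real.Gamma_pos_of_pos hs
  rw [besselEKernel, lintegral_weylKernel_mul_weylKernel,
    ← lintegral_const_mul' _ _ ENNReal.ofReal_ne_top,
    ← lintegral_mul_const' _ _ ENNReal.ofReal_ne_top, lintegral_Ioo_zero_one_eq_sq hx hxy]
  refine setLIntegral_congr_fun measurableSet_Ioo fun w hw => ?_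
  have hw0 : 0 < w := hx.trans hw.1
  have hP : 0 < y ^ 2 - w ^ 2 := by nlinarith [hw.2]
  have hQ : 0 < w ^ 2 - x ^ 2 := by nlinarith [hw.1]
  have e : 1 - (y ^ 2 - w ^ 2) / (y ^ 2 - x ^ 2) = (w ^ 2 - x ^ 2) / (y ^ 2 - x ^ 2) := by
    field_simp
    ring
  have e2 : 1 - (1 - x ^ 2 / y ^ 2) * ((y ^ 2 - w ^ 2) / (y ^ 2 - x ^ 2)) = w ^ 2 / y ^ 2 := by
    field_simp
    ring
  rw [weylKernel_of_lt hx hw.1, weylKernel_of_lt hw0 hw.2, eulerIntegrand, e, e2]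
  simp (disch := positivity) only [← ENNReal.ofReal_mul]
  congr 1
  refine Real.log_injOn_pos (mem_Ioi.2 (by positivity)) (mem_Ioi.2 (by positivity)) ?_
  rw [show (4 : ℝ) = 2 ^ 2 by norm_num]
  simp (disch := positivity) only [Real.log_mul, Real.log_div, Real.log_rpow, Real.log_pow]
  push_cast
  ring

theorem besselKernel_eq_integral_eulerIntegrand {s ν x y : ℝ} (hs : 0 < s) (hx : 0 < x)
    (hxy : x < y) :
    besselKernel s ν x y = ∫ t in Ioo (0 : ℝ) 1, eulerIntegrand s ν x y t := by
  have hy : 0 < y := hx.trans hxy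
  have hz : |1 - x ^ 2 / y ^ 2| < 1 := by
    have h1 : x ^ 2 / y ^ 2 < 1 := (div_lt_one (by positivity)).2 (by nlinarith)
    have h2 : 0 < x ^ 2 / y ^ 2 := by positivity
    rw [abs_lt]
    constructor <;> linarith
  have h := integral_euler_ordinaryHypergeometric (s + (ν - 1) / 2) hs hs hz
  have hΓ := Real.Gamma_pos_of_pos hs
  have hΓ2 := Real.Gamma_pos_of_pos (add_pos hs hs)
  simp only [eulerIntegrand]
  rw [integral_div, integral_const_mul, show -s - (ν - 1) / 2 = -(s + (ν - 1) / 2) by ring, h,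
    besselKernel, ← two_mul] at *
  field_simp

theorem besselKernel_eq_toReal {s ν x y : ℝ} (hs : 0 < s) (hx : 0 < x) (hxy : x < y) :
    besselKernel s ν x y = (besselEKernel s ν x y).toReal := by
  rw [besselKernel_eq_integral_eulerIntegrand hs hx hxy,
    besselEKernel_eq_lintegral_eulerIntegrand hs hx hxy,
    integral_eq_lintegral_of_nonneg_ae _ (by fun_prop)]
  exact (ae_restrict_iff' measurableSet_Ioo).2
    (ae_of_all _ fun t ht => (eulerIntegrand_pos hs hx hxy ht).le)

theorem enorm_besselKernel {s ν x y : ℝ} (hs : 0 < s) (hν : 0 ≤ ν) (hx : 0 < x) (hxy : x < y) :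
    ‖besselKernel s ν x y‖ₑ = besselEKernel s ν x y := by
  rw [besselKernel_eq_toReal hs hx hxy, Real.enorm_of_nonneg ENNReal.toReal_nonneg,
    ENNReal.ofReal_toReal (besselEKernel_lt_top hs hν).ne]

/-! ### Operators on the half-line and their iterates. -/

/-- The fractional Bessel integral on nonnegative functions, written with `besselEKernel`. -/
noncomputable def besselEIntegral (s ν : ℝ) (h : ℝ → ℝ≥0∞) (x : ℝ) : ℝ≥0∞ :=
  ∫⁻ y in Ioi 0, besselEKernel s ν x y * h y

/-- The fractional Bessel integral on complex functions, written with `besselEKernel`. -/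
noncomputable def besselCIntegral (s ν : ℝ) (f : ℝ → ℂ) (x : ℝ) : ℂ :=
  ∫ y in Ioi 0, ((besselEKernel s ν x y).toReal : ℂ) * f y

theorem besselEIntegral_eq_Ioi (s ν : ℝ) (h : ℝ → ℝ≥0∞) {x : ℝ} (hx : 0 < x) :
    besselEIntegral s ν h x = ∫⁻ y in Ioi x, besselEKernel s ν x y * h y := by
  rw [besselEIntegral, ← lintegral_indicator measurableSet_Ioi,
    ← lintegral_indicator measurableSet_Ioi]
  refine lintegral_congr fun y => ?_
  by_cases hy : x < y
  · rw [indicator_of_mem (mem_Ioi.2 (hx.trans hy)), indicator_of_mem (mem_Ioi.2 hy)]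
  · rw [indicator_of_notMem (mt mem_Ioi.1 hy)]
    refine indicator_apply_eq_zero.2 fun _ => ?_
    rw [besselEKernel_of_not_lt fun h => hy h.2, zero_mul]

theorem besselLIntegral_eq {s ν : ℝ} (hs : 0 < s) (hν : 0 ≤ ν) (h : ℝ → ℝ≥0∞) {x : ℝ}
    (hx : 0 < x) : besselLIntegral s ν h x = besselEIntegral s ν h x := by
  rw [besselEIntegral_eq_Ioi _ _ _ hx]
  exact setLIntegral_congr_fun measurableSet_Ioi fun y hy => by
    rw [enorm_besselKernel hs hν hx hy]

theorem besselIntegral_eq {s ν : ℝ} (hs : 0 < s) (f : ℝ → ℂ) {x : ℝ} (hx : 0 < x) :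
    besselIntegral s ν f x = besselCIntegral s ν f x := by
  rw [besselCIntegral, besselIntegral, ← integral_indicator measurableSet_Ioi,
    ← integral_indicator measurableSet_Ioi]
  refine integral_congr_ae (ae_of_all _ fun y => ?_)
  by_cases hy : x < y
  · simp only [indicator_of_mem (mem_Ioi.2 (hx.trans hy)), indicator_of_mem (mem_Ioi.2 hy),
      besselKernel_eq_toReal hs hx hy]
  · simp only [indicator_of_notMem (mt mem_Ioi.1 hy)]
    refine (indicator_apply_eq_zero.2 fun _ => ?_).symm
    rw [besselEKernel_of_not_lt fun h => hy h.2]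
    simp

theorem besselEIntegral_congr {s ν x : ℝ} {h g : ℝ → ℝ≥0∞} (hhg : ∀ y, 0 < y → h y = g y) :
    besselEIntegral s ν h x = besselEIntegral s ν g x :=
  setLIntegral_congr_fun measurableSet_Ioi fun y hy => by rw [hhg y hy]

theorem besselEIntegral_congr_ae {s ν x : ℝ} {h g : ℝ → ℝ≥0∞}
    (hhg : h =ᵐ[volume.restrict (Ioi 0)] g) :
    besselEIntegral s ν h x = besselEIntegral s ν g x :=
  lintegral_congr_ae (hhg.mono fun y hy => by simp only [hy])

theorem besselCIntegral_congr {s ν x : ℝ} {f g : ℝ → ℂ} (hfg : ∀ y, 0 < y → f y = g y) :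
    besselCIntegral s ν f x = besselCIntegral s ν g x :=
  setIntegral_congr_fun measurableSet_Ioi fun y hy => by simp only [hfg y hy]

theorem besselEIntegral_mono {s ν x : ℝ} {h g : ℝ → ℝ≥0∞} (hhg : ∀ y, 0 < y → h y ≤ g y) :
    besselEIntegral s ν h x ≤ besselEIntegral s ν g x :=
  setLIntegral_mono' measurableSet_Ioi fun y hy => mul_le_mul' le_rfl (hhg y hy)

theorem besselEIntegral_const_mul {s ν x : ℝ} {c : ℝ≥0∞} (hc : c ≠ ∞) (h : ℝ → ℝ≥0∞) :
    besselEIntegral s ν (fun y => c * h y) x = c * besselEIntegral s ν h x := by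
  rw [besselEIntegral, besselEIntegral, ← lintegral_const_mul' _ _ hc]
  simp only [mul_left_comm]

theorem measurable_besselEIntegral {s ν : ℝ} {h : ℝ → ℝ≥0∞}
    (hh : AEMeasurable h (volume.restrict (Ioi 0))) : Measurable (besselEIntegral s ν h) := by
  have h1 : besselEIntegral s ν h = besselEIntegral s ν (hh.mk h) :=
    funext fun x => besselEIntegral_congr_ae hh.ae_eq_mk
  rw [h1]
  have := hh.measurable_mk
  exact Measurable.lintegral_prod_right'
    (f := fun q : ℝ × ℝ => besselEKernel s ν q.1 q.2 * hh.mk h q.2) (by fun_prop)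

theorem besselEIntegral_add {s ν x : ℝ} {h g : ℝ → ℝ≥0∞}
    (hh : AEMeasurable h (volume.restrict (Ioi 0))) :
    besselEIntegral s ν (fun y => h y + g y) x =
      besselEIntegral s ν h x + besselEIntegral s ν g x := by
  simp only [besselEIntegral, mul_add]
  exact lintegral_add_left' (AEMeasurable.mul (by fun_prop) hh) _

theorem besselEIntegral_tsum {s ν x : ℝ} {h : ℕ → ℝ → ℝ≥0∞}
    (hh : ∀ k, AEMeasurable (h k) (volume.restrict (Ioi 0))) :
    besselEIntegral s ν (fun y => ∑' k, h k y) x = ∑' k, besselEIntegral s ν (h k) x := by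
  simp only [besselEIntegral, ← ENNReal.tsum_mul_left]
  exact lintegral_tsum fun k => AEMeasurable.mul (by fun_prop) (hh k)

theorem setLIntegral_besselEKernel_comp {s t : ℝ} (hs : 0 < s) (ht : 0 < t) (ν x y : ℝ) :
    ∫⁻ z in Ioi 0, besselEKernel s ν x z * besselEKernel t ν z y =
      besselEKernel (s + t) ν x y := by
  rw [← lintegral_besselEKernel_comp hs ht, ← lintegral_indicator measurableSet_Ioi]
  refine lintegral_congr fun z => ?_
  rw [indicator_apply_eq_self]
  intro hz
  rw [besselEKernel_of_not_lt fun h => hz (h.1.trans h.2), zero_mul]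

/-- The semigroup property of fractional Bessel integrals on nonnegative functions. -/
theorem besselEIntegral_besselEIntegral {s t ν : ℝ} (hs : 0 < s) (ht : 0 < t) {h : ℝ → ℝ≥0∞}
    (hh : AEMeasurable h (volume.restrict (Ioi 0))) (x : ℝ) :
    besselEIntegral s ν (besselEIntegral t ν h) x = besselEIntegral (s + t) ν h x := by
  have h1 : besselEIntegral t ν h = besselEIntegral t ν (hh.mk h) :=
    funext fun x => besselEIntegral_congr_ae hh.ae_eq_mk
  rw [h1, besselEIntegral_congr_ae hh.ae_eq_mk]
  have hm := hh.measurable_mk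
  set g := hh.mk h
  simp only [besselEIntegral]
  calc _ = ∫⁻ z in Ioi 0, ∫⁻ y in Ioi 0,
        besselEKernel s ν x z * (besselEKernel t ν z y * g y) := by
        refine lintegral_congr fun z => (lintegral_const_mul _ (by fun_prop)).symm
    _ = ∫⁻ y in Ioi 0, ∫⁻ z in Ioi 0,
        besselEKernel s ν x z * (besselEKernel t ν z y * g y) :=
        lintegral_lintegral_swap (Measurable.aemeasurable (by unfold Function.uncurry; fun_prop))
    _ = _ := by
        refine lintegral_congr fun y => ?_
        simp only [← mul_assoc]
        rw [lintegral_mul_const _ (by fun_prop), setLIntegral_besselEKernel_comp hs ht]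

theorem besselAbsIter_zero (s ν : ℝ) (f : ℝ → ℂ) (x : ℝ) : besselAbsIter s ν f 0 x = ‖f x‖ₑ := rfl

theorem besselAbsIter_succ' {s ν : ℝ} (hs : 0 < s) (hν : 0 ≤ ν) (f : ℝ → ℂ) (k : ℕ) {x : ℝ}
    (hx : 0 < x) :
    besselAbsIter s ν f (k + 1) x = besselEIntegral s ν (besselAbsIter s ν f k) x := by
  rw [besselAbsIter, Function.iterate_succ_apply', besselLIntegral_eq hs hν _ hx, besselAbsIter]

/-- Repeated use of the semigroup law collapses the iterates to one integral. The index starts at `k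
+ 1` because order `0` is the identity and has no kernel. -/
theorem besselAbsIter_succ {s ν : ℝ} (hs : 0 < s) (hν : 0 ≤ ν) {f : ℝ → ℂ}
    (hf : AEStronglyMeasurable f (volume.restrict (Ioi 0))) (k : ℕ) {x : ℝ} (hx : 0 < x) :
    besselAbsIter s ν f (k + 1) x =
      besselEIntegral ((k + 1 : ℕ) * s) ν (fun y => ‖f y‖ₑ) x := by
  induction k generalizing x with
  | zero => rw [besselAbsIter_succ' hs hν _ _ hx]; simp [besselAbsIter]
  | succ k ih =>
    rw [besselAbsIter_succ' hs hν _ _ hx, besselEIntegral_congr fun y hy => ih hy,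
      besselEIntegral_besselEIntegral hs (by positivity) hf.enorm]
    congr 1
    push_cast
    ring

theorem aemeasurable_besselAbsIter {s ν : ℝ} (hs : 0 < s) (hν : 0 ≤ ν) {f : ℝ → ℂ}
    (hf : AEStronglyMeasurable f (volume.restrict (Ioi 0))) (k : ℕ) :
    AEMeasurable (besselAbsIter s ν f k) (volume.restrict (Ioi 0)) := by
  cases k with
  | zero => exact hf.enorm
  | succ k =>
    refine (measurable_besselEIntegral (s := (k + 1 : ℕ) * s) (ν := ν)
      hf.enorm).aemeasurable.congr ?_
    exact (ae_restrict_iff' measurableSet_Ioi).2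
      (ae_of_all _ fun x hx => (besselAbsIter_succ hs hν hf k hx).symm)

theorem aestronglyMeasurable_besselEKernel_mul {s ν x : ℝ} {f : ℝ → ℂ}
    (hf : AEStronglyMeasurable f (volume.restrict (Ioi 0))) :
    AEStronglyMeasurable (fun y => ((besselEKernel s ν x y).toReal : ℂ) * f y)
      (volume.restrict (Ioi 0)) :=
  AEStronglyMeasurable.mul (Measurable.aestronglyMeasurable (by fun_prop)) hf

theorem enorm_besselEKernel_mul {s ν : ℝ} (hs : 0 < s) (hν : 0 ≤ ν) (x y : ℝ) (z : ℂ) :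
    ‖((besselEKernel s ν x y).toReal : ℂ) * z‖ₑ = besselEKernel s ν x y * ‖z‖ₑ := by
  rw [enorm_mul, ← ofReal_norm ((_ : ℝ) : ℂ), Complex.norm_real,
    Real.norm_of_nonneg ENNReal.toReal_nonneg,
    ENNReal.ofReal_toReal (besselEKernel_lt_top hs hν).ne]

theorem integrable_besselEKernel_mul {s ν x : ℝ} (hs : 0 < s) (hν : 0 ≤ ν) {f : ℝ → ℂ}
    (hf : AEStronglyMeasurable f (volume.restrict (Ioi 0)))
    (hfin : besselEIntegral s ν (fun y => ‖f y‖ₑ) x < ∞) :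
    Integrable (fun y => ((besselEKernel s ν x y).toReal : ℂ) * f y)
      (volume.restrict (Ioi 0)) := by
  refine ⟨aestronglyMeasurable_besselEKernel_mul hf, ?_⟩
  rw [hasFiniteIntegral_iff_enorm]
  simp only [enorm_besselEKernel_mul hs hν]
  exact hfin

theorem enorm_besselCIntegral_le {s ν x : ℝ} (hs : 0 < s) (hν : 0 ≤ ν) (f : ℝ → ℂ) :
    ‖besselCIntegral s ν f x‖ₑ ≤ besselEIntegral s ν (fun y => ‖f y‖ₑ) x := by
  refine (enorm_integral_le_lintegral_enorm _).trans_eq ?_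
  simp only [enorm_besselEKernel_mul hs hν, besselEIntegral]

theorem stronglyMeasurable_besselCIntegral {s ν : ℝ} {f : ℝ → ℂ}
    (hf : AEStronglyMeasurable f (volume.restrict (Ioi 0))) :
    StronglyMeasurable (besselCIntegral s ν f) := by
  have h1 : besselCIntegral s ν f = fun x =>
      ∫ y in Ioi 0, ((besselEKernel s ν x y).toReal : ℂ) * hf.mk f y :=
    funext fun x => integral_congr_ae (hf.ae_eq_mk.mono fun y hy => by simp only [hy])
  rw [h1]
  have := hf.stronglyMeasurable_mk.measurable
  exact StronglyMeasurable.integral_prod_right'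
    (f := fun q : ℝ × ℝ => ((besselEKernel s ν q.1 q.2).toReal : ℂ) * hf.mk f q.2)
    (Measurable.stronglyMeasurable (by fun_prop))

/-- The semigroup property of fractional Bessel integrals on complex functions. -/
theorem besselCIntegral_besselCIntegral {s t ν x : ℝ} (hs : 0 < s) (ht : 0 < t) (hν : 0 ≤ ν)
    {f : ℝ → ℂ} (hf : AEStronglyMeasurable f (volume.restrict (Ioi 0)))
    (hfin : besselEIntegral (s + t) ν (fun y => ‖f y‖ₑ) x < ∞) :
    besselCIntegral s ν (besselCIntegral t ν f) x = besselCIntegral (s + t) ν f x := by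
  set M := volume.restrict (Ioi (0 : ℝ)) with hM
  have hprod : Integrable (Function.uncurry fun z y : ℝ => ((besselEKernel s ν x z).toReal : ℂ) *
      (((besselEKernel t ν z y).toReal : ℂ) * f y)) (M.prod M) := by
    have hmeas : AEStronglyMeasurable (Function.uncurry fun z y : ℝ =>
        ((besselEKernel s ν x z).toReal : ℂ) * (((besselEKernel t ν z y).toReal : ℂ) * f y))
        (M.prod M) := by
      unfold Function.uncurry
      refine AEStronglyMeasurable.mul (Measurable.aestronglyMeasurable (by fun_prop))
        (AEStronglyMeasurable.mul (Measurable.aestronglyMeasurable (by fun_prop)) ?_)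
      exact hf.comp_snd
    refine ⟨hmeas, ?_⟩
    rw [hasFiniteIntegral_iff_enorm, lintegral_prod _ hmeas.enorm]
    simp only [Function.uncurry, enorm_besselEKernel_mul hs hν, enorm_besselEKernel_mul ht hν]
    rw [← besselEIntegral_besselEIntegral hs ht hf.enorm] at hfin
    refine lt_of_eq_of_lt ?_ hfin
    refine lintegral_congr fun z => ?_
    exact lintegral_const_mul' _ _ (besselEKernel_lt_top hs hν).ne
  simp only [besselCIntegral]
  calc _ = ∫ z in Ioi 0, ∫ y in Ioi 0, ((besselEKernel s ν x z).toReal : ℂ) *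
      (((besselEKernel t ν z y).toReal : ℂ) * f y) := by
        simp only [integral_const_mul]
    _ = ∫ y in Ioi 0, ∫ z in Ioi 0, ((besselEKernel s ν x z).toReal : ℂ) *
      (((besselEKernel t ν z y).toReal : ℂ) * f y) := integral_integral_swap hprod
    _ = _ := by
        refine integral_congr_ae (ae_of_all _ fun y => ?_)
        simp only [← mul_assoc]
        rw [integral_mul_const]
        congr 1
        -- The `z`-integrand is a nonnegative real function, so the integral can be moved to `[0,
        -- ∞]`, where the kernel identity holds.
        simp only [← Complex.ofReal_mul, ← ENNReal.toReal_mul]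
        rw [integral_complex_ofReal, integral_toReal (by fun_prop)
          (ae_of_all _ fun z => ENNReal.mul_lt_top (besselEKernel_lt_top hs hν)
            (besselEKernel_lt_top ht hν)), setLIntegral_besselEKernel_comp hs ht]

theorem iterate_besselIntegral {s ν : ℝ} (hs : 0 < s) (hν : 0 ≤ ν) {f : ℝ → ℂ}
    (hf : AEStronglyMeasurable f (volume.restrict (Ioi 0)))
    (hfin : ∀ k : ℕ, ∀ x, 0 < x → besselAbsIter s ν f k x < ∞) (k : ℕ) {x : ℝ} (hx : 0 < x) :
    (besselIntegral s ν)^[k + 1] f x = besselCIntegral ((k + 1 : ℕ) * s) ν f x := by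
  induction k generalizing x with
  | zero => simp [besselIntegral_eq hs f hx]
  | succ k ih =>
    have e : s + ((k + 1 : ℕ) : ℝ) * s = (k + 1 + 1 : ℕ) * s := by push_cast; ring
    rw [Function.iterate_succ_apply', besselIntegral_eq hs _ hx,
      besselCIntegral_congr fun y hy => ih hy,
      besselCIntegral_besselCIntegral hs (by positivity) hν hf, e]
    rw [e, ← besselAbsIter_succ hs hν hf _ hx]
    exact hfin _ x hx

theorem enorm_iterate_besselIntegral_le {s ν : ℝ} (hs : 0 < s) (hν : 0 ≤ ν) {f : ℝ → ℂ}
    (hf : AEStronglyMeasurable f (volume.restrict (Ioi 0)))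
    (hfin : ∀ k : ℕ, ∀ x, 0 < x → besselAbsIter s ν f k x < ∞) (k : ℕ) {x : ℝ} (hx : 0 < x) :
    ‖(besselIntegral s ν)^[k] f x‖ₑ ≤ besselAbsIter s ν f k x := by
  cases k with
  | zero => exact le_rfl
  | succ k =>
    rw [iterate_besselIntegral hs hν hf hfin k hx, besselAbsIter_succ hs hν hf k hx]
    exact enorm_besselCIntegral_le (by positivity) hν f

theorem aestronglyMeasurable_iterate_besselIntegral {s ν : ℝ} (hs : 0 < s) (hν : 0 ≤ ν)
    {f : ℝ → ℂ} (hf : AEStronglyMeasurable f (volume.restrict (Ioi 0)))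
    (hfin : ∀ k : ℕ, ∀ x, 0 < x → besselAbsIter s ν f k x < ∞) (k : ℕ) :
    AEStronglyMeasurable ((besselIntegral s ν)^[k] f) (volume.restrict (Ioi 0)) := by
  cases k with
  | zero => exact hf
  | succ k =>
    refine (stronglyMeasurable_besselCIntegral (s := (k + 1 : ℕ) * s) (ν := ν)
      hf).aestronglyMeasurable.congr ?_
    exact (ae_restrict_iff' measurableSet_Ioi).2
      (ae_of_all _ fun x hx => (iterate_besselIntegral hs hν hf hfin k hx).symm)

/-! ### Termwise integration and the Mittag-Leffler expansion. -/

theorem enorm_le_tsum_enorm_of_hasSum {F : ℕ → ℂ} {z : ℂ} (h : HasSum F z) :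
    ‖z‖ₑ ≤ ∑' k, ‖F k‖ₑ := by
  refine le_of_tendsto ((continuous_enorm.tendsto z).comp h.tendsto_sum_nat)
    (Eventually.of_forall fun n => ?_)
  exact (enorm_sum_le _ _).trans (ENNReal.sum_le_tsum _)

theorem integrable_and_hasSum_integral {β : Type*} [MeasurableSpace β] {μ : Measure β}
    {F : ℕ → β → ℂ} {G : β → ℂ} (hF : ∀ k, AEStronglyMeasurable (F k) μ)
    (hfin : ∑' k, ∫⁻ b, ‖F k b‖ₑ ∂μ < ∞) (hG : ∀ᵐ b ∂μ, HasSum (fun k => F k b) (G b)) :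
    Integrable G μ ∧ HasSum (fun k => ∫ b, F k b ∂μ) (∫ b, G b ∂μ) := by
  have hint : ∀ k, Integrable (F k) μ := fun k =>
    ⟨hF k, (ENNReal.le_tsum k).trans_lt hfin⟩
  have hGm : AEStronglyMeasurable G μ := by
    refine aestronglyMeasurable_of_tendsto_ae atTop
      (f := fun n b => ∑ k ∈ Finset.range n, F k b) (fun n => ?_)
      (hG.mono fun b hb => hb.tendsto_sum_nat)
    exact Finset.aestronglyMeasurable_fun_sum _ fun k _ => hF k
  refine ⟨⟨hGm, ?_⟩, ?_⟩
  · refine lt_of_le_of_lt ?_ hfin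
    rw [← lintegral_tsum fun k => (hF k).enorm]
    exact lintegral_mono_ae (hG.mono fun b hb => enorm_le_tsum_enorm_of_hasSum hb)
  · have hs : Summable fun k => ∫ b, ‖F k b‖ ∂μ := by
      have : (fun k => ∫ b, ‖F k b‖ ∂μ) = fun k => (∫⁻ b, ‖F k b‖ₑ ∂μ).toReal :=
        funext fun k => integral_norm_eq_lintegral_enorm (hF k)
      rw [this]
      exact ENNReal.summable_toReal hfin.ne
    have h := hasSum_integral_of_summable_integral_norm hint hs
    rwa [integral_congr_ae (hG.mono fun b hb => hb.tsum_eq)] at h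

/-- Only the part of Euler's integral over `(R, R + 1]` is kept; there `t^(s-1) ≥ R^s/(R+1)` and
`e^(-t) ≥ e^(-(R+1))`. The constant does not depend on `s`. -/
theorem exists_mul_rpow_le_Gamma {R : ℝ} (hR : 0 < R) :
    ∃ C, 0 < C ∧ ∀ s, 0 < s → C * R ^ s ≤ Real.Gamma s := by
  refine ⟨Real.exp (-(R + 1)) / (R + 1), by positivity, fun s hs => ?_⟩
  rw [Real.Gamma_eq_integral hs]
  calc _ = ∫ _t in Ioc R (R + 1), Real.exp (-(R + 1)) / (R + 1) * R ^ s := by simp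
    _ ≤ ∫ t in Ioc R (R + 1), Real.exp (-t) * t ^ (s - 1) := by
        refine setIntegral_mono_on (integrableOn_const (by simp)) ((Real.GammaIntegral_convergent hs).mono_set
          fun t ht => hR.trans ht.1) measurableSet_Ioc fun t ht => ?_
        have ht0 : 0 < t := hR.trans ht.1
        rw [Real.rpow_sub_one ht0.ne', div_mul_eq_mul_div, mul_div_assoc]
        have h1 : Real.exp (-(R + 1)) ≤ Real.exp (-t) := Real.exp_le_exp.2 (by linarith [ht.2])
        have h2 : R ^ s ≤ t ^ s := Real.rpow_le_rpow hR.le ht.1.le hs.le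
        have h3 : R ^ s / (R + 1) ≤ t ^ s / t := div_le_div₀ (by positivity) h2 ht0 ht.2
        gcongr
    _ ≤ _ := by
        refine setIntegral_mono_set (Real.GammaIntegral_convergent hs) ?_
          (Eventually.of_forall fun t ht => hR.trans ht.1)
        exact (ae_restrict_iff' measurableSet_Ioi).2
          (ae_of_all _ fun t ht => by have : 0 < t := ht; simp only [Pi.zero_apply]; positivity)

theorem hasSum_multiMittagLeffler_two {α : ℝ} (hα : 0 < α) (z : ℂ) :
    HasSum (fun k : ℕ => z ^ k / ((Real.Gamma ((k + 1 : ℕ) * α) ^ 2 : ℝ) : ℂ))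
      (multiMittagLeffler ![α, α] ![α, α] z) := by
  have hprod : ∀ k : ℕ, ∏ i, (Real.Gamma ((![α, α] : Fin 2 → ℝ) i + k * (![α, α] : Fin 2 → ℝ) i) : ℂ)
      = ((Real.Gamma ((k + 1 : ℕ) * α) ^ 2 : ℝ) : ℂ) := by
    intro k
    have : α + k * α = (k + 1 : ℕ) * α := by push_cast; ring
    simp [Fin.prod_univ_two, ← sq, -Nat.cast_add, this]
  unfold multiMittagLeffler
  simp only [hprod]
  refine Summable.hasSum ?_
  set B : ℝ := 2 * (‖z‖ + 1) with hB
  have hB0 : 0 < B := by positivity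
  -- This `R` makes `Γ((k+1)α)²` at least `C² B^(k+1)`. Since `B ≥ 2‖z‖`, the series is dominated by
  -- a geometric one of ratio `1/2`.
  obtain ⟨C, hC, hle⟩ := exists_mul_rpow_le_Gamma (R := B ^ (1 / (2 * α))) (by positivity)
  have hg : Summable fun k : ℕ => (C ^ 2)⁻¹ * (1 / 2 : ℝ) ^ k :=
    (summable_geometric_of_lt_one (by norm_num) (by norm_num)).mul_left _
  refine Summable.of_norm_bounded hg fun k => ?_
  have hs : 0 < ((k + 1 : ℕ) : ℝ) * α := by positivity
  have h1 := hle _ hs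
  have hpow : ((B ^ (1 / (2 * α))) ^ (((k + 1 : ℕ) : ℝ) * α)) ^ 2 = B ^ (k + 1) := by
    rw [← Real.rpow_mul hB0.le, ← Real.rpow_natCast _ 2, ← Real.rpow_mul hB0.le,
      ← Real.rpow_natCast _ (k + 1)]
    congr 1
    push_cast
    field_simp
  have hΓ : C ^ 2 * B ^ (k + 1) ≤ Real.Gamma ((k + 1 : ℕ) * α) ^ 2 := by
    rw [← hpow, ← mul_pow]
    exact pow_le_pow_left₀ (by positivity) h1 2
  rw [norm_div, norm_pow, Complex.norm_real, Real.norm_of_nonneg (sq_nonneg _)]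
  have hzB : ‖z‖ ^ k * 2 ^ k ≤ B ^ (k + 1) := by
    rw [← mul_pow, pow_succ]
    have h2 : (‖z‖ * 2) ^ k ≤ B ^ k := by gcongr; linarith
    have h3 : 1 ≤ B := by linarith [norm_nonneg z]
    exact h2.trans (le_mul_of_one_le_right (by positivity) h3)
  calc ‖z‖ ^ k / Real.Gamma ((k + 1 : ℕ) * α) ^ 2 ≤ ‖z‖ ^ k / (C ^ 2 * B ^ (k + 1)) := by gcongr
    _ ≤ (C ^ 2)⁻¹ * (1 / 2 : ℝ) ^ k := by
        rw [div_le_iff₀ (by positivity), one_div, inv_pow]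
        calc ‖z‖ ^ k = (2 ^ k)⁻¹ * (‖z‖ ^ k * 2 ^ k) := by field_simp
          _ ≤ (2 ^ k)⁻¹ * B ^ (k + 1) := by gcongr
          _ = _ := by field_simp

/-- Raising the order of the Euler integrand by `α` multiplies its power factors by the `α`-th power
of `((y² - x²)/(2y))² t(1-t) / (1 - (1 - x²/y²)t)`. Up to the factor `1/λ` this is the
Mittag-Leffler argument, and the squared Gamma factors are the normalisations. -/
theorem hasSum_resolventIntegrand {α ν x y t : ℝ} (hα : 0 < α) (lam : ℂ) (hx : 0 < x)
    (hxy : x < y) (ht : t ∈ Ioo (0 : ℝ) 1) :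
    HasSum (fun k : ℕ => (1 / lam) ^ k * (eulerIntegrand ((k + 1 : ℕ) * α) ν x y t : ℂ))
      (resolventIntegrand α ν lam x y t) := by
  have hy : 0 < y := hx.trans hxy
  have hD : 0 < y ^ 2 - x ^ 2 := by nlinarith
  have h0 := ht.1
  have h1 : 0 < 1 - t := sub_pos.2 ht.2
  have e : 1 - (1 - x ^ 2 / y ^ 2) * t = (y ^ 2 - (y ^ 2 - x ^ 2) * t) / y ^ 2 := by
    field_simp
  have hE : 0 < y ^ 2 - (y ^ 2 - x ^ 2) * t := by nlinarith [ht.2]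
  unfold resolventIntegrand
  refine ((hasSum_multiMittagLeffler_two hα _).mul_left _).congr_fun fun k => ?_
  have hΓ : 0 < Real.Gamma ((k + 1 : ℕ) * α) := Real.Gamma_pos_of_pos (by positivity)
  rw [eulerIntegrand, mul_pow, e]
  have key : ((y ^ 2 - x ^ 2) / (2 * y)) ^ (2 * (((k + 1 : ℕ) : ℝ) * α) - 1) *
      (t ^ (((k + 1 : ℕ) : ℝ) * α - 1) * (1 - t) ^ (((k + 1 : ℕ) : ℝ) * α - 1) *
      ((y ^ 2 - (y ^ 2 - x ^ 2) * t) / y ^ 2) ^ (-(((k + 1 : ℕ) : ℝ) * α) - (ν - 1) / 2)) =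
      ((y ^ 2 - x ^ 2) / (2 * y)) ^ (2 * α - 1) * (t ^ (α - 1) * (1 - t) ^ (α - 1) *
      ((y ^ 2 - (y ^ 2 - x ^ 2) * t) / y ^ 2) ^ (-α - (ν - 1) / 2)) *
      ((1 / 4 * (t * (1 - t) * (y ^ 2 - x ^ 2) ^ 2 / (y ^ 2 - (y ^ 2 - x ^ 2) * t))) ^ α) ^ k := by
    refine Real.log_injOn_pos (mem_Ioi.2 (by positivity)) (mem_Ioi.2 (by positivity)) ?_
    rw [show (4 : ℝ) = 2 ^ 2 by norm_num]
    simp (disch := positivity) only [Real.log_mul, Real.log_div, Real.log_rpow, Real.log_pow,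
      Real.log_one]
    push_cast
    ring
  rw [key]
  push_cast
  ring

/-! ### The Neumann series and the resolvent formula. -/

section
variable {α ν : ℝ} {lam : ℂ} {f : ℝ → ℂ}

theorem enorm_one_div_pow (lam : ℂ) (hlam : lam ≠ 0) (k : ℕ) :
    ‖(1 / lam) ^ k‖ₑ = (‖lam‖ₑ⁻¹) ^ k := by
  rw [enorm_pow, one_div, enorm_inv hlam]

theorem NeumannConvergent.besselAbsIter_lt_top (h : NeumannConvergent α ν lam f)
    (k : ℕ) (x : ℝ) (hx : 0 < x) : besselAbsIter α ν f k x < ∞ := by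
  have h1 : (‖lam‖ₑ⁻¹) ^ k * besselAbsIter α ν f k x < ∞ :=
    (ENNReal.le_tsum k).trans_lt (h.2 x hx)
  by_contra hc
  rw [not_lt, top_le_iff] at hc
  rw [hc, ENNReal.mul_top (pow_ne_zero _ (ENNReal.inv_ne_zero.2 enorm_ne_top))] at h1
  exact lt_irrefl _ h1

theorem NeumannConvergent.tsum_succ_lt_top (h : NeumannConvergent α ν lam f)
    {x : ℝ} (hx : 0 < x) (n : ℕ) :
    ∑' k : ℕ, (‖lam‖ₑ⁻¹) ^ (k + n) * besselAbsIter α ν f (k + n) x < ∞ :=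
  (ENNReal.tsum_comp_le_tsum_of_injective (add_left_injective n)
    fun k => (‖lam‖ₑ⁻¹) ^ k * besselAbsIter α ν f k x).trans_lt (h.2 x hx)

theorem NeumannConvergent.tsum_succ_lt_top' (hlam : lam ≠ 0) (h : NeumannConvergent α ν lam f)
    {x : ℝ} (hx : 0 < x) :
    ∑' k : ℕ, (‖lam‖ₑ⁻¹) ^ k * besselAbsIter α ν f (k + 1) x < ∞ := by
  have h1 : ∀ k : ℕ, (‖lam‖ₑ⁻¹) ^ k * besselAbsIter α ν f (k + 1) x =
      ‖lam‖ₑ * ((‖lam‖ₑ⁻¹) ^ (k + 1) * besselAbsIter α ν f (k + 1) x) := by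
    intro k
    rw [pow_succ', mul_assoc, ← mul_assoc, ENNReal.mul_inv_cancel (enorm_ne_zero.2 hlam)
      enorm_ne_top, one_mul]
  simp only [h1, ENNReal.tsum_mul_left]
  exact ENNReal.mul_lt_top enorm_lt_top (h.tsum_succ_lt_top hx 1)

theorem lintegral_enorm_eulerIntegrand {s ν x y : ℝ} (hs : 0 < s) (hx : 0 < x) (hxy : x < y) :
    ∫⁻ t in Ioo (0 : ℝ) 1, ‖(eulerIntegrand s ν x y t : ℂ)‖ₑ = besselEKernel s ν x y := by
  rw [besselEKernel_eq_lintegral_eulerIntegrand hs hx hxy]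
  refine setLIntegral_congr_fun measurableSet_Ioo fun t ht => ?_
  rw [← ofReal_norm, Complex.norm_real, Real.norm_of_nonneg (eulerIntegrand_pos hs hx hxy ht).le]

/-- Termwise integration of the expansion of the resolvent integrand. -/
theorem NeumannConvergent.integrable_and_hasSum (hα : 0 < α) (hν : 0 ≤ ν) (hlam : lam ≠ 0)
    (h : NeumannConvergent α ν lam f) {x : ℝ} (hx : 0 < x) :
    Integrable (fun p : ℝ × ℝ => f p.1 * resolventIntegrand α ν lam x p.1 p.2)
      ((volume.restrict (Ioi x)).prod (volume.restrict (Ioo 0 1))) ∧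
    HasSum (fun k : ℕ => (1 / lam) ^ k * (besselIntegral α ν)^[k + 1] f x)
      (∫ y in Ioi x, f y * ∫ t in (0 : ℝ)..1, resolventIntegrand α ν lam x y t) := by
  have hfx : AEStronglyMeasurable f (volume.restrict (Ioi x)) :=
    h.1.mono_measure (Measure.restrict_mono (Ioi_subset_Ioi hx.le) le_rfl)
  have hs : ∀ k : ℕ, 0 < ((k + 1 : ℕ) : ℝ) * α := fun k => by positivity
  set μ := (volume.restrict (Ioi x)).prod (volume.restrict (Ioo (0 : ℝ) 1)) with hμ
  set F : ℕ → ℝ × ℝ → ℂ := fun k p => f p.1 * ((1 / lam) ^ k *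
    (eulerIntegrand ((k + 1 : ℕ) * α) ν x p.1 p.2 : ℂ)) with hF
  have hFm : ∀ k, AEStronglyMeasurable (F k) μ := fun k =>
    AEStronglyMeasurable.mul hfx.comp_fst (Measurable.aestronglyMeasurable (by fun_prop))
  -- By positivity of the Euler integrand the `L¹` norm of the `k`-th term is exactly a Neumann term
  -- of `|f|`, up to one factor `|λ|`.
  have hFl : ∀ k, ∫⁻ p, ‖F k p‖ₑ ∂μ = (‖lam‖ₑ⁻¹) ^ k * besselAbsIter α ν f (k + 1) x := by
    intro k
    rw [lintegral_prod _ (hFm k).enorm, besselAbsIter_succ hα hν h.1 k hx,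
      besselEIntegral_eq_Ioi _ _ _ hx, ← lintegral_const_mul' _ _
        (ENNReal.pow_ne_top (ENNReal.inv_ne_top.2 (enorm_ne_zero.2 hlam)))]
    refine setLIntegral_congr_fun measurableSet_Ioi fun y hy => ?_
    simp only [hF, enorm_mul]
    rw [lintegral_const_mul' _ _ enorm_ne_top, lintegral_const_mul' _ _ enorm_ne_top,
      lintegral_enorm_eulerIntegrand (hs k) hx hy, enorm_one_div_pow lam hlam]
    ring
  have hFs : ∑' k, ∫⁻ p, ‖F k p‖ₑ ∂μ < ∞ := by
    simp only [hFl]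
    exact h.tsum_succ_lt_top' hlam hx
  have hae : ∀ᵐ p ∂μ, HasSum (fun k => F k p) (f p.1 * resolventIntegrand α ν lam x p.1 p.2) := by
    rw [hμ, Measure.prod_restrict]
    refine (ae_restrict_iff' (measurableSet_Ioi.prod measurableSet_Ioo)).2 (ae_of_all _ ?_)
    rintro ⟨y, t⟩ ⟨hy, ht⟩
    exact (hasSum_resolventIntegrand hα lam hx hy ht).mul_left (f y)
  obtain ⟨h1, h2⟩ := integrable_and_hasSum_integral hFm hFs hae
  refine ⟨h1, ?_⟩
  have hFint : ∀ k, Integrable (F k) μ := fun k => ⟨hFm k, (ENNReal.le_tsum k).trans_lt hFs⟩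
  rw [integral_prod _ h1] at h2
  convert h2 using 1
  · funext k
    rw [integral_prod _ (hFint k), iterate_besselIntegral hα hν h.1
      (h.besselAbsIter_lt_top) k hx, ← besselIntegral_eq (hs k) f hx, besselIntegral,
      ← integral_const_mul]
    refine setIntegral_congr_fun measurableSet_Ioi fun y hy => ?_
    simp only [hF]
    rw [integral_const_mul, integral_const_mul, integral_complex_ofReal,
      ← besselKernel_eq_integral_eulerIntegrand (hs k) hx hy]
    ring
  · refine setIntegral_congr_fun measurableSet_Ioi fun y hy => ?_
    simp only
    rw [integral_const_mul, intervalIntegral.integral_of_le zero_le_one,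
      integral_Ioc_eq_integral_Ioo]

theorem NeumannConvergent.hasSum_resolventFormula (hα : 0 < α) (hν : 0 ≤ ν) (hlam : lam ≠ 0)
    (h : NeumannConvergent α ν lam f) {x : ℝ} (hx : 0 < x) :
    HasSum (fun k : ℕ => -(1 / lam) * ((1 / lam) ^ k * ((besselIntegral α ν)^[k] f) x))
      (resolventFormula α ν lam f x) := by
  have h2 := ((h.integrable_and_hasSum hα hν hlam hx).2.mul_left (-(1 / lam ^ 2)))
  -- The term `k = 0` is the free term `-f/λ`; the double integral accounts for `k ≥ 1`.
  rw [← hasSum_nat_add_iff' 1, Finset.sum_range_one]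
  have e : resolventFormula α ν lam f x -
      -(1 / lam) * ((1 / lam) ^ 0 * (besselIntegral α ν)^[0] f x) =
      -(1 / lam ^ 2) * ∫ y in Ioi x, f y * ∫ t in (0 : ℝ)..1, resolventIntegrand α ν lam x y t := by
    rw [resolventFormula, Function.iterate_zero, id]
    ring
  rw [e]
  refine h2.congr_fun fun k => ?_
  rw [pow_succ]
  ring
end

/-! ### Solution of the resolvent equation and uniqueness. -/

section
variable {α ν : ℝ} {lam : ℂ} {f g : ℝ → ℂ}

theorem NeumannConvergent.neumannNull (h : NeumannConvergent α ν lam f) :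
    NeumannNull α ν lam f :=
  ⟨h.1, fun x hx => ⟨h.besselAbsIter_lt_top 1 x hx,
    ENNReal.tendsto_atTop_zero_of_tsum_ne_top (h.2 x hx).ne⟩⟩

theorem enorm_neumannTerm (hlam : lam ≠ 0) (k : ℕ) (z : ℂ) :
    ‖-(1 / lam) * ((1 / lam) ^ k * z)‖ₑ = ‖lam‖ₑ⁻¹ * ((‖lam‖ₑ⁻¹) ^ k * ‖z‖ₑ) := by
  rw [enorm_mul, enorm_mul, enorm_one_div_pow lam hlam, enorm_neg, one_div, enorm_inv hlam]

theorem NeumannConvergent.aestronglyMeasurable_resolventFormula (hα : 0 < α) (hν : 0 ≤ ν)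
    (hlam : lam ≠ 0) (h : NeumannConvergent α ν lam f) :
    AEStronglyMeasurable (resolventFormula α ν lam f) (volume.restrict (Ioi 0)) := by
  refine aestronglyMeasurable_of_tendsto_ae atTop (f := fun n x => ∑ k ∈ Finset.range n,
    -(1 / lam) * ((1 / lam) ^ k * ((besselIntegral α ν)^[k] f) x)) (fun n => ?_) ?_
  · refine Finset.aestronglyMeasurable_fun_sum _ fun k _ => ?_
    exact ((aestronglyMeasurable_iterate_besselIntegral hα hν h.1
      h.besselAbsIter_lt_top k).const_mul _).const_mul _
  · exact (ae_restrict_iff' measurableSet_Ioi).2 (ae_of_all _ fun x hx =>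
      (h.hasSum_resolventFormula hα hν hlam hx).tendsto_sum_nat)

/-- The positive operator commutes with sums of nonnegative functions, so each application shifts
the Neumann majorant by one index. After multiplication by `|λ|^(-n)` the bound is a constant times
a tail of a convergent series, which puts the resolvent in the null class. -/
theorem NeumannConvergent.besselAbsIter_resolventFormula_le (hα : 0 < α) (hν : 0 ≤ ν)
    (hlam : lam ≠ 0) (h : NeumannConvergent α ν lam f) (n : ℕ) {x : ℝ} (hx : 0 < x) :
    besselAbsIter α ν (resolventFormula α ν lam f) n x ≤
      ‖lam‖ₑ⁻¹ * ∑' k : ℕ, (‖lam‖ₑ⁻¹) ^ k * besselAbsIter α ν f (k + n) x := by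
  have hr : ‖lam‖ₑ⁻¹ ≠ ∞ := ENNReal.inv_ne_top.2 (enorm_ne_zero.2 hlam)
  induction n generalizing x with
  | zero =>
    rw [besselAbsIter_zero]
    refine (enorm_le_tsum_enorm_of_hasSum (h.hasSum_resolventFormula hα hν hlam hx)).trans ?_
    simp only [enorm_neumannTerm hlam, ENNReal.tsum_mul_left, add_zero]
    gcongr with k
    exact enorm_iterate_besselIntegral_le hα hν h.1 h.besselAbsIter_lt_top k hx
  | succ n ih =>
    rw [besselAbsIter_succ' hα hν _ _ hx]
    refine (besselEIntegral_mono fun y hy => ih hy).trans_eq ?_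
    rw [besselEIntegral_const_mul hr, besselEIntegral_tsum fun k =>
      (aemeasurable_besselAbsIter hα hν h.1 _).const_mul _]
    congr 1
    refine tsum_congr fun k => ?_
    rw [besselEIntegral_const_mul (ENNReal.pow_ne_top hr), ← add_assoc,
      besselAbsIter_succ' hα hν _ _ hx]

theorem NeumannConvergent.neumannNull_resolventFormula (hα : 0 < α) (hν : 0 ≤ ν)
    (hlam : lam ≠ 0) (h : NeumannConvergent α ν lam f) :
    NeumannNull α ν lam (resolventFormula α ν lam f) := by
  have hr : ‖lam‖ₑ⁻¹ ≠ ∞ := ENNReal.inv_ne_top.2 (enorm_ne_zero.2 hlam)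
  refine ⟨h.aestronglyMeasurable_resolventFormula hα hν hlam, fun x hx => ⟨?_, ?_⟩⟩
  · refine (h.besselAbsIter_resolventFormula_le hα hν hlam 1 hx).trans_lt ?_
    exact ENNReal.mul_lt_top hr.lt_top (h.tsum_succ_lt_top' hlam hx)
  · have h1 := ENNReal.Tendsto.const_mul (ENNReal.tendsto_sum_nat_add _ (h.2 x hx).ne)
      (Or.inr hr)
    rw [mul_zero] at h1
    refine tendsto_of_tendsto_of_tendsto_of_le_of_le tendsto_const_nhds h1
      (fun _ => zero_le) fun n => ?_
    refine (mul_le_mul' le_rfl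
      (h.besselAbsIter_resolventFormula_le hα hν hlam n hx)).trans_eq ?_
    rw [mul_left_comm, ← ENNReal.tsum_mul_left]
    simp only [pow_add]
    congr 2
    funext k
    ring

/-- Telescoping: the series of `B R f` and `λ R f` agree except for the zeroth term of the latter,
which is `-f`. -/
theorem NeumannConvergent.solvesResolventEq (hα : 0 < α) (hν : 0 ≤ ν)
    (hlam : lam ≠ 0) (h : NeumannConvergent α ν lam f) :
    SolvesResolventEq α ν lam f (resolventFormula α ν lam f) := by
  intro x hx
  have hr : ‖lam‖ₑ⁻¹ ≠ ∞ := ENNReal.inv_ne_top.2 (enorm_ne_zero.2 hlam)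
  have hm := fun k => aestronglyMeasurable_iterate_besselIntegral hα hν h.1
    h.besselAbsIter_lt_top k
  set F : ℕ → ℝ → ℂ := fun k y => ((besselEKernel α ν x y).toReal : ℂ) *
    (-(1 / lam) * ((1 / lam) ^ k * ((besselIntegral α ν)^[k] f) y)) with hF
  have hFs : ∑' k, ∫⁻ y in Ioi 0, ‖F k y‖ₑ < ∞ := by
    refine lt_of_le_of_lt ?_ (ENNReal.mul_lt_top hr.lt_top (h.tsum_succ_lt_top' hlam hx))
    rw [← ENNReal.tsum_mul_left]
    refine ENNReal.tsum_le_tsum fun k => ?_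
    simp only [hF, enorm_besselEKernel_mul hα hν, enorm_neumannTerm hlam]
    rw [besselAbsIter_succ' hα hν _ _ hx, ← besselEIntegral_const_mul (ENNReal.pow_ne_top hr),
      ← besselEIntegral_const_mul hr]
    exact besselEIntegral_mono fun y hy => mul_le_mul' le_rfl (mul_le_mul' le_rfl
      (enorm_iterate_besselIntegral_le hα hν h.1 h.besselAbsIter_lt_top k hy))
  have hae : ∀ᵐ y ∂volume.restrict (Ioi 0), HasSum (fun k => F k y)
      (((besselEKernel α ν x y).toReal : ℂ) * resolventFormula α ν lam f y) :=
    (ae_restrict_iff' measurableSet_Ioi).2 (ae_of_all _ fun y hy =>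
      (h.hasSum_resolventFormula hα hν hlam hy).mul_left _)
  obtain ⟨-, h2⟩ := integrable_and_hasSum_integral (fun k =>
    aestronglyMeasurable_besselEKernel_mul (((hm k).const_mul _).const_mul _)) hFs hae
  rw [← besselCIntegral, ← besselIntegral_eq hα _ hx] at h2
  have h3 : HasSum (fun k : ℕ => -(1 / lam) * ((1 / lam) ^ k * ((besselIntegral α ν)^[k + 1] f) x))
      (besselIntegral α ν (resolventFormula α ν lam f) x) := by
    refine h2.congr_fun fun k => ?_
    simp only [mul_left_comm (Complex.ofReal _)]
    rw [integral_const_mul, integral_const_mul, Function.iterate_succ_apply',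
      besselIntegral_eq hα _ hx, besselCIntegral]
  have h4 := (h.hasSum_resolventFormula hα hν hlam hx).mul_left lam
  rw [← hasSum_nat_add_iff' 1, Finset.sum_range_one] at h4
  have h5 : HasSum (fun k : ℕ => -(1 / lam) * ((1 / lam) ^ k * ((besselIntegral α ν)^[k + 1] f) x))
      (lam * resolventFormula α ν lam f x -
        lam * (-(1 / lam) * ((1 / lam) ^ 0 * (besselIntegral α ν)^[0] f x))) := by
    refine h4.congr_fun fun k => ?_
    rw [pow_succ]
    field_simp
  rw [h3.unique h5, Function.iterate_zero, id]
  field_simp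
  ring

theorem NeumannNull.integrable (hα : 0 < α) (hν : 0 ≤ ν) (h : NeumannNull α ν lam g) {x : ℝ}
    (hx : 0 < x) : Integrable (fun y => ((besselEKernel α ν x y).toReal : ℂ) * g y)
      (volume.restrict (Ioi 0)) := by
  refine integrable_besselEKernel_mul hα hν h.1 ?_
  have := (h.2 x hx).1
  rwa [besselAbsIter_succ' hα hν _ _ hx] at this

/-- A difference of two solutions vanishes, since it is dominated by its own Neumann terms. -/
theorem NeumannNull.eq_of_solves (hα : 0 < α) (hν : 0 ≤ ν) (hlam : lam ≠ 0) {g₁ g₂ : ℝ → ℂ}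
    (h₁ : NeumannNull α ν lam g₁) (h₂ : NeumannNull α ν lam g₂)
    (hs₁ : SolvesResolventEq α ν lam f g₁) (hs₂ : SolvesResolventEq α ν lam f g₂) {x : ℝ}
    (hx : 0 < x) : g₁ x = g₂ x := by
  have hr : ‖lam‖ₑ⁻¹ ≠ ∞ := ENNReal.inv_ne_top.2 (enorm_ne_zero.2 hlam)
  have hstep : ∀ y, 0 < y → g₁ y - g₂ y =
      1 / lam * besselCIntegral α ν (fun z => g₁ z - g₂ z) y := by
    intro y hy
    have h3 : besselCIntegral α ν (fun z => g₁ z - g₂ z) y =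
        besselIntegral α ν g₁ y - besselIntegral α ν g₂ y := by
      rw [besselIntegral_eq hα _ hy, besselIntegral_eq hα _ hy, besselCIntegral]
      simp only [mul_sub]
      exact integral_sub (h₁.integrable hα hν hy) (h₂.integrable hα hν hy)
    rw [h3]
    field_simp
    linear_combination hs₂ y hy - hs₁ y hy
  -- The triangle inequality starts the induction, and `d = λ⁻¹ B d` advances it. Iterating `|g₁|`
  -- and `|g₂|` separately makes the null condition on each applicable.
  have hbound : ∀ k : ℕ, ∀ y, 0 < y → ‖g₁ y - g₂ y‖ₑ ≤ (‖lam‖ₑ⁻¹) ^ k * besselAbsIter α ν g₁ k y +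
      (‖lam‖ₑ⁻¹) ^ k * besselAbsIter α ν g₂ k y := by
    intro k
    induction k with
    | zero =>
      intro y hy
      simpa [besselAbsIter_zero] using enorm_sub_le (a := g₁ y) (b := g₂ y)
    | succ k ih =>
      intro y hy
      rw [hstep y hy, enorm_mul, one_div, enorm_inv hlam]
      calc _ ≤ ‖lam‖ₑ⁻¹ * besselEIntegral α ν (fun y => (‖lam‖ₑ⁻¹) ^ k * besselAbsIter α ν g₁ k y +
            (‖lam‖ₑ⁻¹) ^ k * besselAbsIter α ν g₂ k y) y := by
            gcongr
            exact (enorm_besselCIntegral_le hα hν _).trans (besselEIntegral_mono ih)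
        _ = _ := by
            rw [besselEIntegral_add ((aemeasurable_besselAbsIter hα hν h₁.1 k).const_mul _),
              besselEIntegral_const_mul (ENNReal.pow_ne_top hr),
              besselEIntegral_const_mul (ENNReal.pow_ne_top hr),
              besselAbsIter_succ' hα hν _ _ hy, besselAbsIter_succ' hα hν _ _ hy]
            ring
  have hlim := (h₁.2 x hx).2.add (h₂.2 x hx).2
  rw [add_zero] at hlim
  have h0 : ‖g₁ x - g₂ x‖ₑ ≤ 0 := ge_of_tendsto' hlim fun k => hbound k x hx
  exact sub_eq_zero.1 (enorm_eq_zero.1 (le_antisymm h0 zero_le))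

theorem SolvesResolventEq.congr (hα : 0 < α) {g' : ℝ → ℂ} (h : SolvesResolventEq α ν lam f g)
    (hg : ∀ x, 0 < x → g' x = g x) : SolvesResolventEq α ν lam f g' := by
  intro x hx
  rw [besselIntegral_eq hα _ hx, besselCIntegral_congr hg, ← besselIntegral_eq hα _ hx, hg x hx]
  exact h x hx

theorem NeumannConvergent.solves_iff (hα : 0 < α) (hν : 0 ≤ ν)
    (hlam : lam ≠ 0) (h : NeumannConvergent α ν lam f) (hg : NeumannNull α ν lam g) :
    SolvesResolventEq α ν lam f g ↔ ∀ x, 0 < x → g x = resolventFormula α ν lam f x :=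
  ⟨fun hs _ hx => hg.eq_of_solves hα hν hlam (h.neumannNull_resolventFormula hα hν hlam) hs
    (h.solvesResolventEq hα hν hlam) hx,
    fun hs => (h.solvesResolventEq hα hν hlam).congr hα hs⟩
end

/-! ### Exponential bounds uniform in the order. -/

theorem one_add_rpow_le_exp {ν δ : ℝ} (hν : 0 ≤ ν) (hδ : 0 < δ) :
    ∃ C, 0 < C ∧ ∀ u, 0 ≤ u → (1 + u) ^ ν ≤ C * Real.exp (δ * u) := by
  -- From `ε ≤ 1` one gets `ε(1 + u) ≤ 1 + εu ≤ e^(εu)`, and `ε(ν + 1) ≤ δ` controls the exponent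
  -- after raising to the power `ν`.
  set ε := min 1 (δ / (ν + 1)) with hε
  have hε0 : 0 < ε := lt_min one_pos (by positivity)
  refine ⟨(ε⁻¹) ^ ν, by positivity, fun u hu => ?_⟩
  have h1 : 1 + u ≤ ε⁻¹ * Real.exp (ε * u) := by
    rw [inv_mul_eq_div, le_div_iff₀ hε0]
    have := Real.add_one_le_exp (ε * u)
    nlinarith [min_le_left 1 (δ / (ν + 1))]
  calc (1 + u) ^ ν ≤ (ε⁻¹ * Real.exp (ε * u)) ^ ν := Real.rpow_le_rpow (by positivity) h1 hν
    _ = (ε⁻¹) ^ ν * Real.exp (ε * u * ν) := by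
        rw [Real.mul_rpow (by positivity) (by positivity), ← Real.exp_mul]
    _ ≤ _ := by
        have h2 : ε * (ν + 1) ≤ δ := (le_div_iff₀ (by positivity)).1 (min_le_right _ _)
        refine mul_le_mul_of_nonneg_left (Real.exp_le_exp.2 ?_) (by positivity)
        nlinarith [mul_nonneg hε0.le hu, mul_le_mul_of_nonneg_right h2 hu]

theorem lintegral_rpow_sub_mul_exp {a c : ℝ} (ha : 0 < a) (hc : 0 < c) (x : ℝ) :
    ∫⁻ y in Ioi x, ENNReal.ofReal ((y - x) ^ (a - 1) / Real.Gamma a * Real.exp (-(c * (y - x)))) =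
      ENNReal.ofReal (c ^ (-a)) := by
  have hΓ := Real.Gamma_pos_of_pos ha
  have h1 : ∫⁻ y in Ioi x, ENNReal.ofReal
      ((y - x) ^ (a - 1) / Real.Gamma a * Real.exp (-(c * (y - x)))) =
      ∫⁻ r in Ioi 0, ENNReal.ofReal (r ^ (a - 1) / Real.Gamma a * Real.exp (-(c * r))) := by
    rw [← lintegral_indicator measurableSet_Ioi, ← lintegral_indicator measurableSet_Ioi]
    conv_rhs => rw [← lintegral_sub_right_eq_self _ x]
    refine lintegral_congr fun y => ?_
    simp only [indicator, mem_Ioi, sub_pos]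
  have h2 := Real.integral_rpow_mul_exp_neg_mul_Ioi ha hc
  have hint : Integrable (fun t : ℝ => t ^ (a - 1) * Real.exp (-(c * t)))
      (volume.restrict (Ioi 0)) := by
    -- A non-integrable function has Bochner integral `0` by convention, contradicting the positive
    -- value in `h2`.
    by_contra hcon
    rw [integral_undef hcon] at h2
    have : 0 < (1 / c) ^ a * Real.Gamma a := by positivity
    exact this.ne h2
  have e : ∀ r : ℝ, r ^ (a - 1) / Real.Gamma a * Real.exp (-(c * r)) =
      (Real.Gamma a)⁻¹ * (r ^ (a - 1) * Real.exp (-(c * r))) := fun r => by ring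
  rw [h1]
  simp only [e]
  rw [← ofReal_integral_eq_lintegral_ofReal (hint.const_mul _), integral_const_mul, h2, one_div,
    Real.inv_rpow hc.le, Real.rpow_neg hc.le]
  · congr 1
    field_simp
  · refine (ae_restrict_iff' measurableSet_Ioi).2 (ae_of_all _ fun t ht => ?_)
    have : 0 < t := ht
    simp only [Pi.zero_apply]
    positivity

/-- The growth of `(y/x)^ν` is absorbed by giving up the rate `c - c'`; what remains is the Laplace
transform of the Riemann–Liouville kernel of order `2s`, namely `c'^(-2s)`. Chosen before `s`, the
constant serves all iterates at once. -/
theorem exists_besselEIntegral_exp_le {ν c c' x₀ : ℝ} (hν : 0 ≤ ν) (hc' : 0 < c') (hcc : c' < c)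
    (hx₀ : 0 < x₀) :
    ∃ C, 0 < C ∧ ∀ s, 0 < s → ∀ x, x₀ ≤ x →
      besselEIntegral s ν (fun y => ENNReal.ofReal (Real.exp (-(c * y)))) x ≤
        ENNReal.ofReal (C * c' ^ (-(2 * s)) * Real.exp (-(c * x))) := by
  -- With `δ = (c - c')x₀` and `u = (y - x)/x₀`, the exponent `δu` is `(c - c')(y - x)`.
  obtain ⟨C, hC, hle⟩ := one_add_rpow_le_exp hν (mul_pos (sub_pos.2 hcc) hx₀)
  refine ⟨2 * C, by positivity, fun s hs x hx => ?_⟩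
  have hx0 : 0 < x := hx₀.trans_le hx
  have hΓ : 0 < Real.Gamma (2 * s) := Real.Gamma_pos_of_pos (by positivity)
  rw [besselEIntegral_eq_Ioi _ _ _ hx0, mul_right_comm, ENNReal.ofReal_mul (by positivity),
    ← lintegral_rpow_sub_mul_exp (by positivity) hc' x,
    ← lintegral_const_mul' _ _ ENNReal.ofReal_ne_top]
  refine setLIntegral_mono' measurableSet_Ioi fun y hy => ?_
  have hyx : 0 < y - x := sub_pos.2 hy
  refine (mul_le_mul' (besselEKernel_le hs hν hx0 hy) le_rfl).trans ?_
  rw [← ENNReal.ofReal_mul' (by positivity), ← ENNReal.ofReal_mul (by positivity)]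
  refine ENNReal.ofReal_le_ofReal ?_
  have h1 : (y / x) ^ ν ≤ C * Real.exp ((c - c') * (y - x)) := by
    have e : y / x = 1 + (y - x) / x := by field_simp; ring
    calc (y / x) ^ ν ≤ (1 + (y - x) / x₀) ^ ν := by
          rw [e]
          gcongr
      _ ≤ _ := hle _ (by positivity)
      _ = _ := by
          congr 2
          field_simp
  have e2 : Real.exp (-(c * y)) = Real.exp (-(c * x)) * Real.exp (-(c' * (y - x))) *
      Real.exp (-((c - c') * (y - x))) := by
    rw [← Real.exp_add, ← Real.exp_add]
    congr 1
    ring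
  calc _ ≤ 2 * (C * Real.exp ((c - c') * (y - x))) * ((y - x) ^ (2 * s - 1) / Real.Gamma (2 * s)) *
        Real.exp (-(c * y)) := by gcongr
    _ = 2 * C * Real.exp (-(c * x)) * ((y - x) ^ (2 * s - 1) / Real.Gamma (2 * s) *
        Real.exp (-(c' * (y - x)))) *
        (Real.exp ((c - c') * (y - x)) * Real.exp (-((c - c') * (y - x)))) := by rw [e2]; ring
    _ = _ := by rw [← Real.exp_add]; simp

/-! ### Continuous functions with exponential decay. -/

theorem ExpDecaying.exists_norm_le {c : ℝ} {f : ℝ → ℂ} (hf : ExpDecaying c f) {x₀ : ℝ}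
    (hx₀ : 0 < x₀) : ∃ K, 0 < K ∧ ∀ y, x₀ ≤ y → ‖f y‖ ≤ K * Real.exp (-(c * y)) := by
  obtain ⟨K₁, hK₁⟩ := hf.2.bound
  obtain ⟨N, hN⟩ := eventually_atTop.1 hK₁
  have hcont : ContinuousOn (fun y => f y * ((Real.exp (c * y) : ℝ) : ℂ)) (Icc x₀ N) :=
    (hf.1.mono fun y hy => hx₀.trans_le hy.1).mul (by fun_prop)
  obtain ⟨K₂, hK₂⟩ := isCompact_Icc.exists_bound_of_continuousOn hcont
  refine ⟨max 1 (max K₁ K₂), by positivity, fun y hy => ?_⟩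
  rcases le_total N y with h | h
  · refine (hN y h).trans ?_
    rw [Real.norm_of_nonneg (Real.exp_pos _).le]
    gcongr
    exact (le_max_left _ _).trans (le_max_right _ _)
  · have h1 := hK₂ y ⟨hy, h⟩
    rw [norm_mul, Complex.norm_real, Real.norm_of_nonneg (Real.exp_pos _).le] at h1
    rw [Real.exp_neg, ← div_eq_mul_inv, le_div_iff₀ (Real.exp_pos _)]
    exact h1.trans ((le_max_right _ _).trans (le_max_right _ _))

theorem ExpDecaying.aestronglyMeasurable {c : ℝ} {f : ℝ → ℂ} (hf : ExpDecaying c f) :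
    AEStronglyMeasurable f (volume.restrict (Ioi 0)) :=
  hf.1.aestronglyMeasurable measurableSet_Ioi

theorem exists_lt_rpow_neg_lt {c a L : ℝ} (hc : 0 < c) (h : c ^ (-a) < L) :
    ∃ c', 0 < c' ∧ c' < c ∧ c' ^ (-a) < L := by
  have hcont : ContinuousAt (fun u : ℝ => u ^ (-a)) c :=
    Real.continuousAt_rpow_const c (-a) (Or.inl hc.ne')
  have h1 : ∀ᶠ u in 𝓝[<] c, u ^ (-a) < L := (hcont.eventually_lt_const h).filter_mono
    nhdsWithin_le_nhds
  have h2 : ∀ᶠ u in 𝓝[<] c, u ∈ Ioo 0 c := Ioo_mem_nhdsLT hc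
  obtain ⟨u, hu, hu2⟩ := (h1.and h2).exists
  exact ⟨u, hu2.1, hu2.2, hu⟩

section
variable {α ν c : ℝ} {lam : ℂ} {f : ℝ → ℂ}

theorem ExpDecaying.exists_besselAbsIter_le (hα : 0 < α) (hν : 0 ≤ ν) (hf : ExpDecaying c f)
    {c' x₀ : ℝ} (hc' : 0 < c') (hcc : c' < c) (hx₀ : 0 < x₀) :
    ∃ C, 0 < C ∧ ∀ k : ℕ, ∀ x, x₀ ≤ x → besselAbsIter α ν f k x ≤
      ENNReal.ofReal (C * (c' ^ (-(2 * α))) ^ k * Real.exp (-(c * x))) := by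
  obtain ⟨K, hK, hfK⟩ := hf.exists_norm_le hx₀
  obtain ⟨C, hC, hle⟩ := exists_besselEIntegral_exp_le hν hc' hcc hx₀
  -- The summand `1` covers `k = 0`, where the bound on `f` itself is needed; `C` covers `k ≥ 1`.
  refine ⟨K * (C + 1), by positivity, fun k x hx => ?_⟩
  have hx0 : 0 < x := hx₀.trans_le hx
  cases k with
  | zero =>
    rw [besselAbsIter_zero, ← ofReal_norm]
    refine ENNReal.ofReal_le_ofReal ((hfK x hx).trans ?_)
    rw [pow_zero, mul_one]
    gcongr
    nlinarith
  | succ k =>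
    rw [besselAbsIter_succ hα hν hf.aestronglyMeasurable k hx0]
    calc _ ≤ ENNReal.ofReal K * besselEIntegral ((k + 1 : ℕ) * α) ν
          (fun y => ENNReal.ofReal (Real.exp (-(c * y)))) x := by
          rw [← besselEIntegral_const_mul ENNReal.ofReal_ne_top, besselEIntegral_eq_Ioi _ _ _ hx0,
            besselEIntegral_eq_Ioi _ _ _ hx0]
          refine setLIntegral_mono' measurableSet_Ioi fun y hy => mul_le_mul' le_rfl ?_
          rw [← ENNReal.ofReal_mul hK.le, ← ofReal_norm]
          exact ENNReal.ofReal_le_ofReal (hfK y (hx.trans (le_of_lt hy)))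
      _ ≤ ENNReal.ofReal K * ENNReal.ofReal
          (C * c' ^ (-(2 * ((k + 1 : ℕ) * α))) * Real.exp (-(c * x))) :=
          mul_le_mul' le_rfl (hle _ (by positivity) x hx)
      _ ≤ _ := by
          rw [← ENNReal.ofReal_mul hK.le, ← Real.rpow_mul_natCast hc'.le]
          refine ENNReal.ofReal_le_ofReal ?_
          rw [show -(2 * (((k + 1 : ℕ) : ℝ) * α)) = -(2 * α) * (k + 1 : ℕ) by ring,
            ← mul_assoc, ← mul_assoc]
          gcongr
          linarith

theorem ExpDecaying.neumannConvergent (hα : 0 < α) (hν : 0 ≤ ν) (hlam : lam ≠ 0) (hc : 0 < c)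
    (hcl : c ^ (-(2 * α)) < ‖lam‖) (hf : ExpDecaying c f) : NeumannConvergent α ν lam f := by
  refine ⟨hf.aestronglyMeasurable, fun x hx => ?_⟩
  obtain ⟨c', hc', hcc, hq⟩ := exists_lt_rpow_neg_lt hc hcl
  obtain ⟨C, hC, hle⟩ := hf.exists_besselAbsIter_le hα hν hc' hcc hx
  set q := c' ^ (-(2 * α)) with hqdef
  have hq0 : 0 < q := by positivity
  have hl : 0 < ‖lam‖ := norm_pos_iff.2 hlam
  have hterm : ∀ k : ℕ, (‖lam‖ₑ⁻¹) ^ k * besselAbsIter α ν f k x ≤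
      ENNReal.ofReal (C * Real.exp (-(c * x))) * ENNReal.ofReal (q / ‖lam‖) ^ k := by
    intro k
    refine (mul_le_mul' le_rfl (hle k x le_rfl)).trans_eq ?_
    rw [← ofReal_norm, ← ENNReal.ofReal_inv_of_pos hl, ← ENNReal.ofReal_pow (by positivity),
      ← ENNReal.ofReal_pow (by positivity), ← ENNReal.ofReal_mul (by positivity),
      ← ENNReal.ofReal_mul (by positivity), div_pow, inv_pow]
    congr 1
    ring
  refine (ENNReal.tsum_le_tsum hterm).trans_lt ?_
  rw [ENNReal.tsum_mul_left, ENNReal.tsum_geometric]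
  refine ENNReal.mul_lt_top ENNReal.ofReal_lt_top (ENNReal.inv_lt_top.2 (tsub_pos_iff_lt.2 ?_))
  rw [ENNReal.ofReal_lt_one, div_lt_one hl]
  exact hq

/-- The kernel is homogeneous, so `y = xr` confines the dependence on `x` to a power and to `f`.
Continuity in `x` then follows by dominated convergence, without differentiating or estimating
differences of kernels. -/
theorem besselIntegral_eq_scaled (hα : 0 < α) {x : ℝ} (hx : 0 < x) (f : ℝ → ℂ) :
    besselIntegral α ν f x = ((x ^ (2 * α) : ℝ) : ℂ) *
      ∫ r in Ioi 1, ((besselEKernel α ν 1 r).toReal : ℂ) * f (x * r) := by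
  have h := integral_comp_mul_left_Ioi (fun y => (besselKernel α ν x y : ℂ) * f y) 1 hx
  rw [mul_one] at h
  have h2 : besselIntegral α ν f x =
      x * ∫ r in Ioi 1, (besselKernel α ν x (x * r) : ℂ) * f (x * r) := by
    rw [h, besselIntegral, Complex.real_smul, Complex.ofReal_inv, mul_inv_cancel_left₀]
    exact_mod_cast hx.ne'
  rw [h2, ← integral_const_mul, ← integral_const_mul]
  refine setIntegral_congr_fun measurableSet_Ioi fun r hr => ?_
  have hr1 : (1 : ℝ) < r := hr
  have hr0 : 0 < r := one_pos.trans hr1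
  have hP : 0 < r ^ 2 - 1 ^ 2 := by nlinarith
  have e1 : ((x * r) ^ 2 - x ^ 2) / (2 * (x * r)) = x * ((r ^ 2 - 1 ^ 2) / (2 * r)) := by
    field_simp
  have e2 : x ^ 2 / (x * r) ^ 2 = 1 ^ 2 / r ^ 2 := by
    field_simp
  have hk : x * besselKernel α ν x (x * r) = x ^ (2 * α) * besselKernel α ν 1 r := by
    rw [besselKernel, besselKernel, e1, e2, Real.mul_rpow hx.le (by positivity),
      Real.rpow_sub_one hx.ne']
    field_simp
  rw [← besselKernel_eq_toReal hα one_pos hr1, ← mul_assoc, ← mul_assoc]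
  exact_mod_cast congrArg (fun u : ℝ => (u : ℂ) * f (x * r)) hk

theorem ExpDecaying.continuousOn_besselIntegral (hα : 0 < α) (hν : 0 ≤ ν) (hc : 0 < c)
    (hf : ExpDecaying c f) : ContinuousOn (besselIntegral α ν f) (Ioi 0) := by
  refine ContinuousOn.congr (f := fun x => ((x ^ (2 * α) : ℝ) : ℂ) *
      ∫ r in Ioi 1, ((besselEKernel α ν 1 r).toReal : ℂ) * f (x * r)) ?_
    fun x hx => besselIntegral_eq_scaled hα hx f
  intro x hx
  have hx0 : 0 < x := hx
  refine ContinuousAt.continuousWithinAt (ContinuousAt.mul ?_ ?_)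
  · exact Complex.continuous_ofReal.continuousAt.comp
      (Real.continuousAt_rpow_const x _ (Or.inl hx0.ne'))
  obtain ⟨K, hK, hfK⟩ := hf.exists_norm_le (half_pos hx0)
  have hnhds : ∀ᶠ u in 𝓝 x, x / 2 < u := lt_mem_nhds (half_lt_self hx0)
  have hd : 0 < c * (x / 2) := by positivity
  -- Near `x` the parameter exceeds `x/2`, so `f` at the scaled point decays at least at rate
  -- `c(x/2)` in `r`.
  refine continuousAt_of_dominated (bound := fun r => (besselEKernel α ν 1 r).toReal *
    (K * Real.exp (-(c * (x / 2) * r)))) ?_ ?_ ?_ ?_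
  · refine hnhds.mono fun u hu => ?_
    refine AEStronglyMeasurable.mul (Measurable.aestronglyMeasurable (by fun_prop)) ?_
    refine ContinuousOn.aestronglyMeasurable (hf.1.comp (by fun_prop) fun r hr => ?_)
      measurableSet_Ioi
    exact mul_pos ((half_pos hx0).trans hu) (one_pos.trans hr)
  · refine hnhds.mono fun u hu => (ae_restrict_iff' measurableSet_Ioi).2 (ae_of_all _ fun r hr => ?_)
    have hr1 : (1 : ℝ) < r := hr
    have hur : x / 2 * r ≤ u * r := by gcongr
    rw [norm_mul, Complex.norm_real, Real.norm_of_nonneg ENNReal.toReal_nonneg]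
    gcongr
    refine (hfK _ ?_).trans ?_
    · nlinarith
    · refine mul_le_mul_of_nonneg_left (Real.exp_le_exp.2 ?_) hK.le
      linarith [mul_le_mul_of_nonneg_left hur hc.le]
  · obtain ⟨C, hC, hle⟩ := exists_besselEIntegral_exp_le hν (half_pos hd) (half_lt_self hd) one_pos
    refine ⟨Measurable.aestronglyMeasurable (by fun_prop), ?_⟩
    rw [hasFiniteIntegral_iff_ofReal (ae_of_all _ fun r => by
      simp only [Pi.zero_apply]; positivity)]
    have h1 := hle α hα 1 le_rfl
    rw [besselEIntegral_eq_Ioi _ _ _ one_pos] at h1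
    calc _ = ENNReal.ofReal K * ∫⁻ r in Ioi 1, besselEKernel α ν 1 r *
          ENNReal.ofReal (Real.exp (-(c * (x / 2) * r))) := by
          rw [← lintegral_const_mul' _ _ ENNReal.ofReal_ne_top]
          refine lintegral_congr fun r => ?_
          rw [ENNReal.ofReal_mul ENNReal.toReal_nonneg,
            ENNReal.ofReal_toReal (besselEKernel_lt_top hα hν).ne, ENNReal.ofReal_mul hK.le]
          ring
      _ < ∞ := ENNReal.mul_lt_top ENNReal.ofReal_lt_top (h1.trans_lt ENNReal.ofReal_lt_top)
  · refine (ae_restrict_iff' measurableSet_Ioi).2 (ae_of_all _ fun r hr => ?_)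
    have hxr : x * r ∈ Ioi (0 : ℝ) := mul_pos hx0 (one_pos.trans hr)
    refine ContinuousAt.mul continuousAt_const ?_
    exact ContinuousAt.comp (f := fun u => u * r) (hf.1.continuousAt (Ioi_mem_nhds hxr))
      (by fun_prop)

theorem norm_le_of_enorm_le {z : ℂ} {r : ℝ} (hr : 0 ≤ r) (h : ‖z‖ₑ ≤ ENNReal.ofReal r) :
    ‖z‖ ≤ r := by
  rwa [← ofReal_norm, ENNReal.ofReal_le_ofReal_iff hr] at h

theorem ExpDecaying.besselIntegral (hα : 0 < α) (hν : 0 ≤ ν) (hc : 0 < c)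
    (hf : ExpDecaying c f) : ExpDecaying c (besselIntegral α ν f) := by
  refine ⟨hf.continuousOn_besselIntegral hα hν hc, ?_⟩
  obtain ⟨C, hC, hle⟩ := hf.exists_besselAbsIter_le hα hν (half_pos hc) (half_lt_self hc) one_pos
  refine Asymptotics.IsBigO.of_bound (C * ((c / 2) ^ (-(2 * α))) ^ 1) ?_
  filter_upwards [eventually_ge_atTop 1] with x hx
  have hx0 : 0 < x := one_pos.trans_le hx
  rw [Real.norm_of_nonneg (Real.exp_pos _).le]
  refine norm_le_of_enorm_le (by positivity) (le_trans ?_ (hle 1 x hx))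
  rw [besselIntegral_eq hα _ hx0, besselAbsIter_succ' hα hν _ _ hx0]
  exact enorm_besselCIntegral_le hα hν f

theorem ExpDecaying.iterate_besselIntegral (hα : 0 < α) (hν : 0 ≤ ν) (hc : 0 < c)
    (hf : ExpDecaying c f) (k : ℕ) : ExpDecaying c ((_root_.besselIntegral α ν)^[k] f) := by
  induction k with
  | zero => exact hf
  | succ k ih =>
    rw [Function.iterate_succ_apply']
    exact ih.besselIntegral hα hν hc

/-- A Weierstrass majorant on `[x₀, ∞)`: it gives local uniform convergence, hence continuity of the
resolvent, and its factor `e^(-cx)` gives the decay. -/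
theorem ExpDecaying.exists_neumannTerm_le (hα : 0 < α) (hν : 0 ≤ ν) (hlam : lam ≠ 0) (hc : 0 < c)
    (hcl : c ^ (-(2 * α)) < ‖lam‖) (hf : ExpDecaying c f) {x₀ : ℝ} (hx₀ : 0 < x₀) :
    ∃ u : ℕ → ℝ, Summable u ∧ ∀ k x, x₀ ≤ x →
      ‖-(1 / lam) * ((1 / lam) ^ k * ((_root_.besselIntegral α ν)^[k] f) x)‖ ≤
        u k * Real.exp (-(c * x)) := by
  obtain ⟨c', hc', hcc, hq⟩ := exists_lt_rpow_neg_lt hc hcl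
  obtain ⟨C, hC, hle⟩ := hf.exists_besselAbsIter_le hα hν hc' hcc hx₀
  have hl : 0 < ‖lam‖ := norm_pos_iff.2 hlam
  refine ⟨fun k => ‖lam‖⁻¹ * C * (c' ^ (-(2 * α)) / ‖lam‖) ^ k,
    (summable_geometric_of_lt_one (by positivity) ((div_lt_one hl).2 hq)).mul_left _,
    fun k x hx => ?_⟩
  have h1 : ‖((_root_.besselIntegral α ν)^[k] f) x‖ ≤
      C * (c' ^ (-(2 * α))) ^ k * Real.exp (-(c * x)) :=
    norm_le_of_enorm_le (by positivity) ((enorm_iterate_besselIntegral_le hα hν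
      hf.aestronglyMeasurable (hf.neumannConvergent hα hν hlam hc hcl).besselAbsIter_lt_top k
      (hx₀.trans_le hx)).trans (hle k x hx))
  beta_reduce
  rw [norm_mul, norm_mul, norm_pow, norm_neg, one_div, norm_inv, div_pow, inv_pow]
  calc _ ≤ ‖lam‖⁻¹ * ((‖lam‖ ^ k)⁻¹ * (C * (c' ^ (-(2 * α))) ^ k * Real.exp (-(c * x)))) := by
        gcongr
    _ = _ := by ring

theorem ExpDecaying.resolventFormula (hα : 0 < α) (hν : 0 ≤ ν) (hlam : lam ≠ 0) (hc : 0 < c)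
    (hcl : c ^ (-(2 * α)) < ‖lam‖) (hf : ExpDecaying c f) :
    ExpDecaying c (resolventFormula α ν lam f) := by
  have hN := hf.neumannConvergent hα hν hlam hc hcl
  constructor
  · intro x hx
    have hx0 : 0 < x := hx
    obtain ⟨u, hu, hle⟩ := hf.exists_neumannTerm_le hα hν hlam hc hcl (half_pos hx0)
    have hcont : ContinuousOn (fun y => ∑' k : ℕ,
        -(1 / lam) * ((1 / lam) ^ k * ((_root_.besselIntegral α ν)^[k] f) y)) (Ioi (x / 2)) := by
      refine continuousOn_tsum (u := u) (fun k => ?_) hu fun k y hy => ?_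
      · exact continuousOn_const.mul (continuousOn_const.mul
          ((hf.iterate_besselIntegral hα hν hc k).1.mono (Ioi_subset_Ioi (half_pos hx0).le)))
      · have hy' : x / 2 < y := hy
        have h1 := hle k y hy'.le
        have h2 : 0 ≤ u k := nonneg_of_mul_nonneg_left ((norm_nonneg _).trans h1) (Real.exp_pos _)
        refine h1.trans (mul_le_of_le_one_right h2 (Real.exp_le_one_iff.2 ?_))
        nlinarith
    have hcont' : ContinuousOn (_root_.resolventFormula α ν lam f) (Ioi (x / 2)) :=
      hcont.congr fun y hy =>
        (hN.hasSum_resolventFormula hα hν hlam ((half_pos hx0).trans hy)).tsum_eq.symm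
    exact (hcont'.continuousAt (Ioi_mem_nhds (half_lt_self hx0))).continuousWithinAt
  · obtain ⟨u, hu, hle⟩ := hf.exists_neumannTerm_le hα hν hlam hc hcl one_pos
    refine Asymptotics.IsBigO.of_bound (∑' k, u k) ?_
    filter_upwards [eventually_ge_atTop 1] with x hx
    rw [Real.norm_of_nonneg (Real.exp_pos _).le,
      ← (hN.hasSum_resolventFormula hα hν hlam (one_pos.trans_le hx)).tsum_eq]
    exact tsum_of_norm_bounded (hu.hasSum.mul_right _) fun k => hle k x hx
end

theorem mainTheorem3 (α ν : ℝ) (hα : 0 < α) (hν : 0 ≤ ν) (lam : ℂ) (hlam : lam ≠ 0) :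
    (∀ f : ℝ → ℂ, NeumannConvergent α ν lam f →
      (∀ x, 0 < x →
        Integrable (fun p : ℝ × ℝ => f p.1 * resolventIntegrand α ν lam x p.1 p.2)
          ((volume.restrict (Ioi x)).prod (volume.restrict (Ioo 0 1)))) ∧
      (∀ x, 0 < x →
        HasSum (fun k : ℕ => -(1 / lam) * ((1 / lam) ^ k * ((besselIntegral α ν)^[k] f) x))
          (resolventFormula α ν lam f x)) ∧
      NeumannNull α ν lam (resolventFormula α ν lam f) ∧
      ∀ g : ℝ → ℂ, NeumannNull α ν lam g →
        (SolvesResolventEq α ν lam f g ↔ ∀ x, 0 < x → g x = resolventFormula α ν lam f x)) ∧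
    (∀ c : ℝ, 0 < c → c ^ (-(2 * α)) < ‖lam‖ →
      ∀ f : ℝ → ℂ, ExpDecaying c f →
        NeumannConvergent α ν lam f ∧
        ExpDecaying c (besselIntegral α ν f) ∧
        ExpDecaying c (resolventFormula α ν lam f) ∧
        ∀ g : ℝ → ℂ, ExpDecaying c g →
          (SolvesResolventEq α ν lam f g ↔
            ∀ x, 0 < x → g x = resolventFormula α ν lam f x)) := by
  refine ⟨fun f hf => ⟨fun x hx => (hf.integrable_and_hasSum hα hν hlam hx).1,
    fun x hx => hf.hasSum_resolventFormula hα hν hlam hx,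
    hf.neumannNull_resolventFormula hα hν hlam, fun g hg => hf.solves_iff hα hν hlam hg⟩,
    fun c hc hcl f hf => ⟨hf.neumannConvergent hα hν hlam hc hcl, hf.besselIntegral hα hν hc,
      hf.resolventFormula hα hν hlam hc hcl, fun g hg => ?_⟩⟩
  -- A decaying `g` has an absolutely convergent Neumann series of its own, whose terms tend to
  -- zero, so it lies in the uniqueness class.
  exact (hf.neumannConvergent hα hν hlam hc hcl).solves_iff hα hν hlam
    (hg.neumannConvergent hα hν hlam hc hcl).neumannNull
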